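/- Let $(X_i,Y_i)_{i\ge 1}$ be i.i.d. $\mathbb{R}^d\times\mathbb{R}^q$-valued random variables with probability density $f(x,y)$ and $\mathbb{E}\|Y_1\|<\infty$. Let $(h_n)_{n\ge1}$ be a sequence of positive numbers with $h_n\to 0$ and $nh_n^d\to\infty$, and let $K:\mathbb{R}^d\to\mathbb{R}$ be bounded and integrable with $\int_{\mathbb{R}^d}K(z)\,dz=1$ and $\lim_{\|z\|\to\infty}K(z)=0$. Fix $x\in\mathbb{R}^d$ with $g(x):=\int_{\mathbb{R}^q}f(x,y)\,dy>0$, and assume that for every $u\in\mathbb{R}^q$ the function $t\mapsto\int_{\mathbb{R}^q}e^{\langle u,y\rangle}f(t,y)\,dy$ is (finite and) bounded on $\mathbb{R}^d$ and continuous at $x$. Define the Nadaraya-Watson estimator by $r_n(x)=m_n(x)/g_n(x)$ if $g_n(x)\ne0$ and $r_n(x)=0$ otherwise, where $$m_n(x)=\frac1{nh_n^d}\sum_{i=1}^nY_iK\Big(\frac{x-X_i}{h_n}\Big),\qquad g_n(x)=\frac1{nh_n^d}\sum_{i=1}^nK\Big(\frac{x-X_i}{h_n}\Big).$$ For $(u,v),(t_1,t_2)\in\mathbb{R}^q\times\mathbb{R}$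 and $s\in\mathbb{R}^q$ put $$\Psi_x(u,v)=\int_{\mathbb{R}^d\times\mathbb{R}^q}\big(e^{(\langle u,y\rangle+v)K(z)}-1\big)f(x,y)\,dz\,dy,$$ $$I_x(t_1,t_2)=\sup_{(u,v)\in\mathbb{R}^q\times\mathbb{R}}\{\langle u,t_1\rangle+vt_2-\Psi_x(u,v)\},\qquad J(s)=\inf_{t\in\mathbb{R}}I_x(st,t).$$ If $K$ is nonnegative and the set $\{z\in\mathbb{R}^d: K(z)>0\}$ has infinite Lebesgue measure, then $J:\mathbb{R}^q\to[0,\infty]$ is a good rate function (it is lower semicontinuous and $\{J\le\alpha\}$ is compact for every $\alpha<\infty$), and $(r_n(x))$ satisfies a large deviations principle with speed $(nh_n^d)$ and rate function $J$: for every open $U\subseteq\mathbb{R}^q$ and every closed $V\subseteq\mathbb{R}^q$, $$\liminf_{n\to\infty}\frac1{nh_n^d}\log\mathbb{P}[r_n(x)\in U]\ \ge\ -\inf_{s\in U}J(s),\qquad \limsup_{n\to\infty}\frac1{nh_n^d}\log\mathbb{P}[r_n(x)\in V]\ \le\ -\inf_{s\in V}J(s).$$ -/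

import Mathlib

open MeasureTheory ProbabilityTheory Filter Topology

/-! Large deviations principles. -/

/-- A speed: a sequence (indexed by `n ≥ 1`) of positive numbers going to infinity. -/
def IsSpeed (ν : ℕ → ℝ) : Prop :=
  (∀ n, 1 ≤ n → 0 < ν n) ∧ Tendsto ν atTop atTop

/-- A rate function: nonnegative, extended-valued and lower semicontinuous
(equivalently, its level sets are closed). -/
def IsRateFunction {E : Type*} [TopologicalSpace E] (I : E → EReal) : Prop :=
  (∀ s, 0 ≤ I s) ∧ LowerSemicontinuous I

/-- A good rate function: a rate function all of whose level sets at finite levels are compact. -/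
def IsGoodRateFunction {E : Type*} [TopologicalSpace E] (I : E → EReal) : Prop :=
  IsRateFunction I ∧ ∀ α : ℝ, IsCompact {s | I s ≤ (α : EReal)}

/-- The sequence `(Z n)` satisfies a large deviations principle under `P` with speed `ν` and
rate function `I`. Here `ENNReal.log 0 = ⊥` and an infimum over the empty set is `⊤`. -/
def SatisfiesLDP {Ω E : Type*} [MeasurableSpace Ω] [TopologicalSpace E]
    (P : Measure Ω) (Z : ℕ → Ω → E) (ν : ℕ → ℝ) (I : E → EReal) : Prop :=
  IsSpeed ν ∧ IsRateFunction I ∧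
  (∀ U : Set E, IsOpen U →
    -(⨅ s ∈ U, I s) ≤
      liminf (fun n => (((ν n)⁻¹ : ℝ) : EReal) * ENNReal.log (P {ω | Z n ω ∈ U})) atTop) ∧
  (∀ V : Set E, IsClosed V →
    limsup (fun n => (((ν n)⁻¹ : ℝ) : EReal) * ENNReal.log (P {ω | Z n ω ∈ V})) atTop ≤
      -(⨅ s ∈ V, I s))

/-! The Nadaraya-Watson estimator. The sample of size `n` is `(X i, Y i)`, `i < n`. -/

/-- `m_n(x) = (n h_n^d)⁻¹ ∑ Y_i K((x - X_i) / h_n)`. -/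
noncomputable def kernelM {Ω : Type*} {d q : ℕ} (K : EuclideanSpace ℝ (Fin d) → ℝ) (h : ℕ → ℝ)
    (X : ℕ → Ω → EuclideanSpace ℝ (Fin d)) (Y : ℕ → Ω → EuclideanSpace ℝ (Fin q))
    (x : EuclideanSpace ℝ (Fin d)) (n : ℕ) (ω : Ω) : EuclideanSpace ℝ (Fin q) :=
  ((n : ℝ) * h n ^ d)⁻¹ • ∑ i ∈ Finset.range n, K ((h n)⁻¹ • (x - X i ω)) • Y i ω

/-- `g_n(x) = (n h_n^d)⁻¹ ∑ K((x - X_i) / h_n)`. -/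
noncomputable def kernelG {Ω : Type*} {d : ℕ} (K : EuclideanSpace ℝ (Fin d) → ℝ) (h : ℕ → ℝ)
    (X : ℕ → Ω → EuclideanSpace ℝ (Fin d))
    (x : EuclideanSpace ℝ (Fin d)) (n : ℕ) (ω : Ω) : ℝ :=
  ((n : ℝ) * h n ^ d)⁻¹ * ∑ i ∈ Finset.range n, K ((h n)⁻¹ • (x - X i ω))

/-- `r_n(x) = m_n(x) / g_n(x)` if `g_n(x) ≠ 0`, and `0` otherwise. -/
noncomputable def nadarayaWatson {Ω : Type*} {d q : ℕ} (K : EuclideanSpace ℝ (Fin d) → ℝ)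
    (h : ℕ → ℝ) (X : ℕ → Ω → EuclideanSpace ℝ (Fin d)) (Y : ℕ → Ω → EuclideanSpace ℝ (Fin q))
    (x : EuclideanSpace ℝ (Fin d)) (n : ℕ) (ω : Ω) : EuclideanSpace ℝ (Fin q) :=
  if kernelG K h X x n ω ≠ 0 then (kernelG K h X x n ω)⁻¹ • kernelM K h X Y x n ω else 0

/-! The rate function. -/

/-- `Ψ_x(u, v) = ∫ (e^{(⟨u, y⟩ + v) K(z)} - 1) f(x, y) dz dy`. -/
noncomputable def regPsi {d q : ℕ} (K : EuclideanSpace ℝ (Fin d) → ℝ)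
    (f : EuclideanSpace ℝ (Fin d) → EuclideanSpace ℝ (Fin q) → ℝ)
    (x : EuclideanSpace ℝ (Fin d)) (u : EuclideanSpace ℝ (Fin q)) (v : ℝ) : ℝ :=
  ∫ p : EuclideanSpace ℝ (Fin d) × EuclideanSpace ℝ (Fin q),
    (Real.exp ((inner ℝ u p.2 + v) * K p.1) - 1) * f x p.2

/-- `I_x(t₁, t₂) = sup_{u, v} (⟨u, t₁⟩ + v t₂ - Ψ_x(u, v))`, the Fenchel-Legendre transform. -/
noncomputable def regI {d q : ℕ} (K : EuclideanSpace ℝ (Fin d) → ℝ)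
    (f : EuclideanSpace ℝ (Fin d) → EuclideanSpace ℝ (Fin q) → ℝ)
    (x : EuclideanSpace ℝ (Fin d)) (t₁ : EuclideanSpace ℝ (Fin q)) (t₂ : ℝ) : EReal :=
  ⨆ (u : EuclideanSpace ℝ (Fin q)) (v : ℝ),
    ((inner ℝ u t₁ + v * t₂ - regPsi K f x u v : ℝ) : EReal)

/-- `J(s) = inf_{t ∈ ℝ} I_x(s t, t)`. -/
noncomputable def regJ {d q : ℕ} (K : EuclideanSpace ℝ (Fin d) → ℝ)
    (f : EuclideanSpace ℝ (Fin d) → EuclideanSpace ℝ (Fin q) → ℝ)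
    (x : EuclideanSpace ℝ (Fin d)) (s : EuclideanSpace ℝ (Fin q)) : EReal :=
  ⨅ t : ℝ, regI K f x (t • s) t

/-! The pair $(m_n,g_n)$ is a normalized sum of i.i.d. vectors with computable cumulants. For one
observation, the substitution $t=x-hz$ turns $\mathbb{E}e^T-1$ into $h^d$ times `scaledPsi`, so the
cumulant at scale $nh_n^d$ is $h_n^{-d}\log(1+h_n^d\,\cdot)$ of a quantity tending to $\Psi_x$
(`tendsto_cgf_kernelPair`). As $\Psi_x$ is finite and differentiable everywhere
(`differentiable_regPsi`), Gärtner-Ellis bounds hold for the pair with rate $I_x$.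

The estimator is the image of the pair under $(a,t)\mapsto a/t$, which is discontinuous at $t=0$, so
the contraction principle does not apply as it stands. The infinite measure of $\{K>0\}$ repairs
this: it forces $\Psi_x(0,v)\to-\infty$ as $v\to-\infty$, hence $I_x=\infty$ on $\{t\le0\}$
(`regI_eq_top`). The level sets of $I_x$ are then compact subsets of $\{t>0\}$, where the quotient
is continuous. This makes $J$ good and lets both bounds pass to the quotient.

For Gärtner-Ellis, the upper bound is Chernoff's inequality on finitely many half-spaces. The lower
bound is exponential tilting at gradients of $\Lambda$ (`gartnerEllis_lower_gradient`). Any point of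
finite rate is approximated by gradients through a quadratic penalty (`gartnerEllis_lower`), so no
theory of exposed points is needed. -/

/-! ### The Gärtner-Ellis bounds in a finite-dimensional inner product space. -/

section GartnerEllis

variable {H : Type*} [NormedAddCommGroup H] [InnerProductSpace ℝ H]

/-- Finitely many linear functionals dominate the norm. -/
lemma exists_finset_norm_le_inner (H : Type*) [NormedAddCommGroup H] [InnerProductSpace ℝ H]
    [FiniteDimensional ℝ H] :
    ∃ W : Finset H, ∀ x : H, x ≠ 0 → ∃ w ∈ W, ‖x‖ ≤ inner ℝ w x := by
  classical
  have hc : IsCompact (Metric.sphere (0 : H) 1) := isCompact_sphere 0 1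
  -- The factor 2 makes each unit vector `x` lie strictly inside its own half-space: `⟨2x, x⟩ = 2 >
  -- 1`.
  obtain ⟨T, hT⟩ := hc.elim_finite_subcover (fun w : H => {x : H | 1 < inner ℝ ((2 : ℝ) • w) x})
    (fun w => isOpen_lt continuous_const (by fun_prop)) (by
      intro x hx
      refine Set.mem_iUnion.2 ⟨x, ?_⟩
      have hx1 : ‖x‖ = 1 := by simpa using hx
      simp [inner_smul_left, hx1])
  refine ⟨T.image (fun w => (2 : ℝ) • w), fun x hx => ?_⟩
  have hx0 : 0 < ‖x‖ := norm_pos_iff.2 hx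
  have hmem : ‖x‖⁻¹ • x ∈ Metric.sphere (0 : H) 1 := by
    simp [norm_smul, hx0.ne']
  obtain ⟨w, hw, hwx⟩ := by simpa only [Set.mem_iUnion, exists_prop] using hT hmem
  refine ⟨(2 : ℝ) • w, Finset.mem_image_of_mem _ hw, ?_⟩
  have h1 : 1 < inner ℝ ((2 : ℝ) • w) (‖x‖⁻¹ • x) := hwx
  rw [inner_smul_right, inv_mul_eq_div, lt_div_iff₀ hx0, one_mul] at h1
  exact h1.le

lemma isBounded_of_inner_le {W : Finset H} (hW : ∀ x : H, x ≠ 0 → ∃ w ∈ W, ‖x‖ ≤ inner ℝ w x)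
    (c : H → ℝ) : Bornology.IsBounded {x : H | ∀ w ∈ W, inner ℝ w x ≤ c w} := by
  refine isBounded_iff_forall_norm_le.2 ⟨∑ w ∈ W, |c w|, fun x hx => ?_⟩
  by_cases h0 : x = 0
  · rw [h0, norm_zero]
    exact Finset.sum_nonneg fun w _ => abs_nonneg _
  · obtain ⟨w, hw, hwx⟩ := hW x h0
    calc ‖x‖ ≤ c w := hwx.trans (hx w hw)
      _ ≤ |c w| := le_abs_self _
      _ ≤ _ := Finset.single_le_sum (f := fun w => |c w|) (fun _ _ => abs_nonneg _) hw

/-- The Fenchel-Legendre transform. -/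
noncomputable def legendre (Λ : H → ℝ) (t : H) : EReal :=
  ⨆ l : H, ((inner ℝ l t - Λ l : ℝ) : EReal)

lemma le_legendre (Λ : H → ℝ) (t l : H) : ((inner ℝ l t - Λ l : ℝ) : EReal) ≤ legendre Λ t :=
  le_iSup (fun l : H => ((inner ℝ l t - Λ l : ℝ) : EReal)) l

variable {Ω : Type*} [MeasurableSpace Ω] {P : Measure Ω} [IsProbabilityMeasure P]
  {Z : ℕ → Ω → H} {ν : ℕ → ℝ} {Λ : H → ℝ}

/-- Two-sided bounds on the moment generating function from the limit of the cumulants. -/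
lemma eventually_mgf_bounds (hν : Tendsto ν atTop atTop)
    (hint : ∀ l, ∀ᶠ n in atTop, Integrable (fun ω => Real.exp (ν n * inner ℝ l (Z n ω))) P)
    (hlim : ∀ l, Tendsto (fun n => (ν n)⁻¹ * cgf (fun ω => inner ℝ l (Z n ω)) P (ν n)) atTop
      (𝓝 (Λ l))) (l : H) {η : ℝ} (hη : 0 < η) :
    ∀ᶠ n in atTop, Real.exp (ν n * (Λ l - η)) ≤ mgf (fun ω => inner ℝ l (Z n ω)) P (ν n) ∧
      mgf (fun ω => inner ℝ l (Z n ω)) P (ν n) ≤ Real.exp (ν n * (Λ l + η)) := by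
  filter_upwards [hν.eventually_gt_atTop 0, hint l,
    (hlim l).eventually (Icc_mem_nhds (sub_lt_self (Λ l) hη) (lt_add_of_pos_right (Λ l) hη))]
    with n hn hi ⟨h1, h2⟩
  have hm := mgf_pos hi
  rw [inv_mul_eq_div, le_div_iff₀ hn] at h1
  rw [inv_mul_eq_div, div_le_iff₀ hn] at h2
  constructor
  · rw [← Real.le_log_iff_exp_le hm]
    simpa [cgf, mul_comm] using h1
  · rw [← Real.log_le_iff_le_exp hm]
    simpa [cgf, mul_comm] using h2

/-- Any constant factor is absorbed by an arbitrarily small loss in the exponential rate. -/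
lemma eventually_mul_exp_le (hν : Tendsto ν atTop atTop) (c : ℝ) {a b : ℝ} (hab : a < b) :
    ∀ᶠ n in atTop, c * Real.exp (ν n * a) ≤ Real.exp (ν n * b) := by
  have h1 : Tendsto (fun n => Real.exp (ν n * (b - a))) atTop atTop :=
    Real.tendsto_exp_atTop.comp (hν.atTop_mul_const (sub_pos.2 hab))
  filter_upwards [h1.eventually_ge_atTop c] with n hn
  calc c * Real.exp (ν n * a) ≤ Real.exp (ν n * (b - a)) * Real.exp (ν n * a) := by gcongr
    _ = Real.exp (ν n * b) := by rw [← Real.exp_add]; ring_nf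

variable [FiniteDimensional ℝ H]

/-- A level set is an intersection of closed half-spaces, one for each `l`. Since `Λ` is finite
everywhere, the finitely many directions in `W` already bound it. -/
lemma isCompact_legendre_le (Λ : H → ℝ) (α : ℝ) :
    IsCompact {t | legendre Λ t ≤ (α : EReal)} := by
  obtain ⟨W, hW⟩ := exists_finset_norm_le_inner H
  have heq : {t | legendre Λ t ≤ (α : EReal)} = ⋂ l : H, {t | inner ℝ l t - Λ l ≤ α} := by
    ext t
    simp only [legendre, Set.mem_ofPred_eq, iSup_le_iff, EReal.coe_le_coe_iff, Set.mem_iInter]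
  refine Metric.isCompact_of_isClosed_isBounded ?_
    ((isBounded_of_inner_le hW (fun w => α + Λ w)).subset ?_)
  · rw [heq]
    exact isClosed_iInter fun l => isClosed_le (by fun_prop) continuous_const
  · rw [heq]
    intro t ht w _
    have := Set.mem_iInter.1 ht w
    simp only [Set.mem_ofPred_eq] at this
    linarith

/-- The Gärtner-Ellis upper bound for closed sets. -/
lemma gartnerEllis_upper (hν : Tendsto ν atTop atTop)
    (hint : ∀ l, ∀ᶠ n in atTop, Integrable (fun ω => Real.exp (ν n * inner ℝ l (Z n ω))) P)
    (hlim : ∀ l, Tendsto (fun n => (ν n)⁻¹ * cgf (fun ω => inner ℝ l (Z n ω)) P (ν n)) atTop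
      (𝓝 (Λ l)))
    {F : Set H} (hF : IsClosed F) {α : ℝ} (hα : (α : EReal) < ⨅ t ∈ F, legendre Λ t) :
    ∀ᶠ n in atTop, P.real {ω | Z n ω ∈ F} ≤ Real.exp (ν n * (-α)) := by
  classical
  obtain ⟨W, hW⟩ := exists_finset_norm_le_inner H
  -- Half of the gap `β - α` pays for the error in the cumulants, the other half for the number of
  -- half-spaces.
  obtain ⟨β, hαβ, hβ⟩ := EReal.lt_iff_exists_real_btwn.1 hα
  have hαβ' : α < β := EReal.coe_lt_coe_iff.1 hαβ
  let S : H → Set H := fun l => {t | β + Λ l < inner ℝ l t}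
  have hS : ∀ l, IsOpen (S l) := fun l => isOpen_lt continuous_const (by fun_prop)
  have hcover : ∀ t ∈ F, ∃ l, t ∈ S l := by
    intro t ht
    have h1 : (β : EReal) < legendre Λ t := hβ.trans_le (iInf₂_le t ht)
    obtain ⟨l, hl⟩ := lt_iSup_iff.1 h1
    refine ⟨l, ?_⟩
    have := EReal.coe_lt_coe_iff.1 hl
    simp only [S, Set.mem_ofPred_eq]
    linarith
  -- This takes the place of exponential tightness: the half-spaces of `W` cover all of `F` but a
  -- compact part.
  have hcpt : IsCompact (F \ ⋃ w ∈ W, S w) := by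
    refine Metric.isCompact_of_isClosed_isBounded
      (hF.sdiff (isOpen_biUnion fun w _ => hS w))
      ((isBounded_of_inner_le hW (fun w => β + Λ w)).subset ?_)
    rintro t ⟨_, ht⟩ w hw
    simp only [S, Set.mem_iUnion, Set.mem_ofPred_eq, exists_prop, not_exists, not_and, not_lt] at ht
    exact ht w hw
  obtain ⟨T, hT⟩ := hcpt.elim_finite_subcover S hS
    (fun t ht => Set.mem_iUnion.2 (hcover t ht.1))
  have hFT : F ⊆ ⋃ l ∈ W ∪ T, S l := by
    intro t ht
    by_cases h : t ∈ ⋃ w ∈ W, S w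
    · exact Set.biUnion_subset_biUnion_left (fun w hw => Finset.mem_union_left T hw) h
    · exact Set.biUnion_subset_biUnion_left (fun w hw => Finset.mem_union_right W hw) (hT ⟨ht, h⟩)
  have hη : 0 < (β - α) / 2 := by linarith
  have hev := (Filter.eventually_all_finset (W ∪ T)).2
    fun l _ => (hint l).and (eventually_mgf_bounds hν hint hlim l hη)
  filter_upwards [hev, hν.eventually_gt_atTop 0,
    eventually_mul_exp_le hν ((W ∪ T).card : ℝ) (show -((α + β) / 2) < -α by linarith)]
    with n hn hn0 hn1
  calc P.real {ω | Z n ω ∈ F} ≤ P.real (⋃ l ∈ W ∪ T, {ω | Z n ω ∈ S l}) := by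
        refine measureReal_mono (fun ω hω => ?_) (measure_ne_top _ _)
        simpa using hFT hω
    _ ≤ ∑ l ∈ W ∪ T, P.real {ω | Z n ω ∈ S l} := measureReal_biUnion_finset_le _ _
    _ ≤ ∑ l ∈ W ∪ T, Real.exp (ν n * -((α + β) / 2)) := by
        refine Finset.sum_le_sum fun l hl => ?_
        obtain ⟨hi, -, hb⟩ := hn l hl
        calc P.real {ω | Z n ω ∈ S l} ≤ P.real {ω | β + Λ l ≤ inner ℝ l (Z n ω)} :=
              measureReal_mono fun ω (hω : _ < _) => Set.mem_ofPred.2 hω.le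
          _ ≤ Real.exp (-(ν n) * (β + Λ l)) * mgf (fun ω => inner ℝ l (Z n ω)) P (ν n) :=
              measure_ge_le_exp_mul_mgf _ hn0.le hi
          _ ≤ Real.exp (-(ν n) * (β + Λ l)) * Real.exp (ν n * (Λ l + (β - α) / 2)) := by gcongr
          _ = _ := by rw [← Real.exp_add]; ring_nf
    _ = (W ∪ T).card * Real.exp (ν n * -((α + β) / 2)) := by simp
    _ ≤ _ := hn1

variable [MeasurableSpace H] [BorelSpace H]

/-- The tilting bound: lower bound near a point which is a gradient of `Λ`. -/
lemma gartnerEllis_lower_gradient (hν : Tendsto ν atTop atTop) (hZ : ∀ n, Measurable (Z n))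
    (hint : ∀ l, ∀ᶠ n in atTop, Integrable (fun ω => Real.exp (ν n * inner ℝ l (Z n ω))) P)
    (hlim : ∀ l, Tendsto (fun n => (ν n)⁻¹ * cgf (fun ω => inner ℝ l (Z n ω)) P (ν n)) atTop
      (𝓝 (Λ l)))
    {l t : H} (hder : ∀ w, HasDerivAt (fun s : ℝ => Λ (l + s • w)) (inner ℝ w t) 0)
    {G : Set H} (hG : IsOpen G) (ht : t ∈ G) {α : ℝ} (hα : inner ℝ l t - Λ l < α) :
    ∀ᶠ n in atTop, Real.exp (ν n * (-α)) ≤ P.real {ω | Z n ω ∈ G} := by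
  classical
  obtain ⟨W, hW⟩ := exists_finset_norm_le_inner H
  obtain ⟨δ₀, hδ₀, hball⟩ := Metric.isOpen_iff.1 hG t ht
  set γ : ℝ := α - (inner ℝ l t - Λ l) with hγ
  have hγ0 : 0 < γ := by rw [hγ]; linarith
  -- On the ball of radius `δ` the tilt `⟨l, ·⟩` varies by at most `‖l‖ * δ`, which may use half of
  -- the slack `γ`.
  obtain ⟨δ, hδ, hδ1, hδ2⟩ : ∃ δ > 0, δ ≤ δ₀ ∧ ‖l‖ * δ ≤ γ / 2 := by
    refine ⟨min δ₀ (γ / 2 / (‖l‖ + 1)), by positivity, min_le_left _ _, ?_⟩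
    calc ‖l‖ * min δ₀ (γ / 2 / (‖l‖ + 1)) ≤ (‖l‖ + 1) * (γ / 2 / (‖l‖ + 1)) := by
          gcongr
          · linarith
          · exact min_le_right _ _
      _ = γ / 2 := by field_simp
  -- a common step size for all directions
  obtain ⟨s, hs0, hs⟩ : ∃ s : ℝ, 0 < s ∧
      ∀ w ∈ W, Λ (l + s • w) ≤ Λ l + s * inner ℝ w t + s * (δ / 2) := by
    have h1 : ∀ w ∈ W, ∀ᶠ s : ℝ in 𝓝[>] 0,
        Λ (l + s • w) ≤ Λ l + s * inner ℝ w t + s * (δ / 2) := by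
      intro w _
      have h2 := (hasDerivAt_iff_isLittleO.1 (hder w)).def (half_pos hδ)
      filter_upwards [h2.filter_mono nhdsWithin_le_nhds, self_mem_nhdsWithin] with s hs hs0
      have hs0' : (0 : ℝ) < s := hs0
      simp only [zero_smul, add_zero, sub_zero, smul_eq_mul, Real.norm_eq_abs,
        abs_of_pos hs0'] at hs
      have := (abs_le.1 hs).2
      linarith
    obtain ⟨s, hs, hs0⟩ := (((Filter.eventually_all_finset W).2 h1).and
      self_mem_nhdsWithin).exists
    exact ⟨s, hs0, hs⟩
  -- The first bound on `κ` makes the exponent `Λ l + κ - s * (δ / 2)` outside the ball smaller than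
  -- `Λ l - κ`, so that at least half of the tilted mass stays inside. The second keeps `‖l‖ * δ +
  -- κ` below `γ`.
  have hκ : 0 < min (s * δ / 8) (γ / 4) := by positivity
  set κ := min (s * δ / 8) (γ / 4) with hκdef
  have hκ1 : κ ≤ s * δ / 8 := min_le_left _ _
  have hκ2 : κ ≤ γ / 4 := min_le_right _ _
  have hev := (Filter.eventually_all_finset W).2
    fun w _ => (hint (l + s • w)).and (eventually_mgf_bounds hν hint hlim (l + s • w) hκ)
  filter_upwards [hev, hint l, eventually_mgf_bounds hν hint hlim l hκ,
    hν.eventually_gt_atTop 0,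
    eventually_mul_exp_le hν (2 * W.card : ℝ)
      (show Λ l + κ - s * (δ / 2) < Λ l - κ by nlinarith),
    eventually_mul_exp_le hν (2 : ℝ) (show -α < -(inner ℝ l t + ‖l‖ * δ) + (Λ l - κ) by linarith)]
    with n hn hil hml hn0 hn1 hn2
  have hmeas : Measurable fun ω => Z n ω := hZ n
  set B : Set Ω := {ω | Z n ω ∈ Metric.ball t δ} with hB
  have hBm : MeasurableSet B := hZ n measurableSet_ball
  -- mass outside the ball under the tilted measure
  have hout : ∫ ω in Bᶜ, Real.exp (ν n * inner ℝ l (Z n ω)) ∂P ≤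
      (W.card : ℝ) * Real.exp (ν n * (Λ l + κ - s * (δ / 2))) := by
    have hterm : ∀ w ∈ W, Integrable (fun ω => Real.exp (-(ν n) * s * (inner ℝ w t + δ)) *
        Real.exp (ν n * inner ℝ (l + s • w) (Z n ω))) P :=
      fun w hw => (hn w hw).1.const_mul _
    calc ∫ ω in Bᶜ, Real.exp (ν n * inner ℝ l (Z n ω)) ∂P
        ≤ ∫ ω in Bᶜ, ∑ w ∈ W, Real.exp (-(ν n) * s * (inner ℝ w t + δ)) *
            Real.exp (ν n * inner ℝ (l + s • w) (Z n ω)) ∂P := by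
          refine setIntegral_mono_on hil.integrableOn
            (integrable_finsetSum _ hterm).integrableOn hBm.compl fun ω hω => ?_
          have hd : δ ≤ ‖Z n ω - t‖ := by
            simpa [hB, dist_eq_norm] using hω
          -- A point outside the ball exceeds `t` by at least `δ` in some direction `w ∈ W`. Tilting
          -- further by `s • w` is then Chernoff's inequality under the tilted measure.
          obtain ⟨w, hw, hwx⟩ := hW (Z n ω - t) (norm_pos_iff.1 (hδ.trans_le hd))
          rw [inner_sub_right] at hwx
          refine le_trans ?_ (Finset.single_le_sum
            (f := fun w => Real.exp (-(ν n) * s * (inner ℝ w t + δ)) *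
              Real.exp (ν n * inner ℝ (l + s • w) (Z n ω))) (fun _ _ => by positivity) hw)
          rw [← Real.exp_add]
          refine Real.exp_le_exp.2 ?_
          rw [inner_add_left, real_inner_smul_left]
          have : 0 ≤ ν n * s * (inner ℝ w (Z n ω) - (inner ℝ w t + δ)) := by
            apply mul_nonneg (by positivity); linarith
          linarith
      _ ≤ ∫ ω, ∑ w ∈ W, Real.exp (-(ν n) * s * (inner ℝ w t + δ)) *
            Real.exp (ν n * inner ℝ (l + s • w) (Z n ω)) ∂P :=
          setIntegral_le_integral (integrable_finsetSum _ hterm)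
            (Eventually.of_forall fun ω => Finset.sum_nonneg fun _ _ => by positivity)
      _ = ∑ w ∈ W, Real.exp (-(ν n) * s * (inner ℝ w t + δ)) *
            mgf (fun ω => inner ℝ (l + s • w) (Z n ω)) P (ν n) := by
          rw [integral_finsetSum _ hterm]
          simp_rw [integral_const_mul]
          rfl
      _ ≤ ∑ w ∈ W, Real.exp (ν n * (Λ l + κ - s * (δ / 2))) := by
          refine Finset.sum_le_sum fun w hw => ?_
          calc _ ≤ Real.exp (-(ν n) * s * (inner ℝ w t + δ)) *
                Real.exp (ν n * (Λ l + s * inner ℝ w t + s * (δ / 2) + κ)) := by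
                gcongr
                refine (hn w hw).2.2.trans (Real.exp_le_exp.2 ?_)
                gcongr
                exact hs w hw
            _ = _ := by rw [← Real.exp_add]; ring_nf
      _ = _ := by simp
  -- mass inside the ball
  have hin : ∫ ω in B, Real.exp (ν n * inner ℝ l (Z n ω)) ∂P ≤
      Real.exp (ν n * (inner ℝ l t + ‖l‖ * δ)) * P.real B := by
    calc _ ≤ ∫ ω in B, Real.exp (ν n * (inner ℝ l t + ‖l‖ * δ)) ∂P := by
          refine setIntegral_mono_on hil.integrableOn (integrable_const _).integrableOn hBm
            fun ω hω => ?_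
          have hd : ‖Z n ω - t‖ < δ := by simpa [hB, dist_eq_norm] using hω
          refine Real.exp_le_exp.2 ?_
          gcongr
          have h1 : inner ℝ l (Z n ω - t) ≤ ‖l‖ * δ :=
            (real_inner_le_norm _ _).trans (by gcongr)
          rw [inner_sub_right] at h1
          linarith
      _ = _ := by simp [mul_comm]
  have hsplit : mgf (fun ω => inner ℝ l (Z n ω)) P (ν n) =
      ∫ ω in B, Real.exp (ν n * inner ℝ l (Z n ω)) ∂P +
        ∫ ω in Bᶜ, Real.exp (ν n * inner ℝ l (Z n ω)) ∂P := (integral_add_compl hBm hil).symm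
  have hhalf : Real.exp (ν n * (Λ l - κ)) ≤
      2 * (Real.exp (ν n * (inner ℝ l t + ‖l‖ * δ)) * P.real B) := by
    have := hml.1
    linarith
  have hBG : P.real B ≤ P.real {ω | Z n ω ∈ G} :=
    measureReal_mono fun ω hω => hball (Metric.ball_subset_ball hδ1 hω)
  refine le_trans ?_ hBG
  rw [mul_add, Real.exp_add, mul_neg (ν n) (inner ℝ l t + ‖l‖ * δ), Real.exp_neg] at hn2
  have hpos := Real.exp_pos (ν n * (inner ℝ l t + ‖l‖ * δ))
  rw [inv_mul_eq_div, le_div_iff₀ hpos] at hn2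
  nlinarith

/-- The Gärtner-Ellis lower bound for open sets, for a differentiable limit. -/
lemma gartnerEllis_lower (hν : Tendsto ν atTop atTop) (hZ : ∀ n, Measurable (Z n))
    (hint : ∀ l, ∀ᶠ n in atTop, Integrable (fun ω => Real.exp (ν n * inner ℝ l (Z n ω))) P)
    (hlim : ∀ l, Tendsto (fun n => (ν n)⁻¹ * cgf (fun ω => inner ℝ l (Z n ω)) P (ν n)) atTop
      (𝓝 (Λ l)))
    (hΛ : Differentiable ℝ Λ) (hΛ0 : Λ 0 = 0)
    {G : Set H} (hG : IsOpen G) {t : H} (ht : t ∈ G) {α : ℝ} (hα : legendre Λ t < (α : EReal)) :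
    ∀ᶠ n in atTop, Real.exp (ν n * (-α)) ≤ P.real {ω | Z n ω ∈ G} := by
  have hle : ∀ l, inner ℝ l t - Λ l < α := fun l =>
    EReal.coe_lt_coe_iff.1 ((le_legendre Λ t l).trans_lt hα)
  have hα0 : 0 < α := by simpa [hΛ0] using hle 0
  obtain ⟨δ, hδ, hball⟩ := Metric.isOpen_iff.1 hG t ht
  -- Chosen so that `ε * ‖l‖ ^ 2 ≤ 2 * α` gives `‖ε • l‖ ^ 2 ≤ δ ^ 2 / 2`.
  set ε : ℝ := δ ^ 2 / (4 * α) with hε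
  have hε0 : 0 < ε := by positivity
  -- The supremum defining `legendre Λ t` need not be attained. The penalty makes the objective
  -- coercive, and stationarity at the maximizer `l` says that the gradient of `Λ` there is `t - ε •
  -- l`, a point near `t`.
  obtain ⟨l, hl⟩ : ∃ l : H, ∀ k : H,
      inner ℝ k t - Λ k - ε / 2 * ‖k‖ ^ 2 ≤ inner ℝ l t - Λ l - ε / 2 * ‖l‖ ^ 2 := by
    refine Continuous.exists_forall_ge (f := fun k : H => inner ℝ k t - Λ k - ε / 2 * ‖k‖ ^ 2) ?_ ?_
    · have := hΛ.continuous
      fun_prop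
    · have h1 : Tendsto (fun k : H => ε / 2 * ‖k‖ ^ 2) (cocompact H) atTop :=
        ((tendsto_pow_atTop two_ne_zero).comp (tendsto_norm_cocompact_atTop)).const_mul_atTop
          (half_pos hε0)
      have h2 : Tendsto (fun k : H => α - ε / 2 * ‖k‖ ^ 2) (cocompact H) atBot :=
        tendsto_atBot_add_const_left _ α (tendsto_neg_atTop_atBot.comp h1)
      exact tendsto_atBot_mono (fun k => by have := hle k; linarith) h2
  have hnorm : ε * ‖l‖ ^ 2 ≤ 2 * α := by
    have h1 := hl 0
    have h2 := hle l
    simp only [inner_zero_left, hΛ0, norm_zero] at h1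
    linarith
  have hmem : t - ε • l ∈ G := by
    apply hball
    rw [Metric.mem_ball, dist_eq_norm, sub_sub_cancel_left, norm_neg, norm_smul, Real.norm_eq_abs,
      abs_of_pos hε0]
    refine lt_of_pow_lt_pow_left₀ 2 hδ.le ?_
    calc (ε * ‖l‖) ^ 2 = ε * (ε * ‖l‖ ^ 2) := by ring
      _ ≤ ε * (2 * α) := by gcongr
      _ = δ ^ 2 / 2 := by rw [hε]; field_simp; norm_num
      _ < δ ^ 2 := by have := pow_pos hδ 2; linarith
  refine gartnerEllis_lower_gradient (l := l) hν hZ hint hlim (fun w => ?_) hG hmem ?_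
  · have hline : HasDerivAt (fun s : ℝ => l + s • w) w 0 := by
      simpa using ((hasDerivAt_id (0 : ℝ)).smul_const w).const_add l
    have hd : HasDerivAt (fun s : ℝ => Λ (l + s • w)) (fderiv ℝ Λ l w) 0 := by
      have h1 : HasFDerivAt Λ (fderiv ℝ Λ l) (l + (0 : ℝ) • w) := by
        simpa using (hΛ l).hasFDerivAt
      exact h1.comp_hasDerivAt 0 hline
    have hq : HasDerivAt (fun s : ℝ => inner ℝ (l + s • w) t - Λ (l + s • w)
        - ε / 2 * (‖l‖ ^ 2 + 2 * s * inner ℝ l w + s ^ 2 * ‖w‖ ^ 2))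
        (inner ℝ w t - fderiv ℝ Λ l w - ε * inner ℝ l w) 0 := by
      have h1 : HasDerivAt (fun s : ℝ => inner ℝ (l + s • w) t) (inner ℝ w t) 0 := by
        have := ((hasDerivAt_id (0 : ℝ)).mul_const (inner ℝ w t)).const_add (inner ℝ l t)
        simpa [inner_add_left, real_inner_smul_left] using this
      have h2 : HasDerivAt (fun s : ℝ => ε / 2 * (‖l‖ ^ 2 + 2 * s * inner ℝ l w + s ^ 2 * ‖w‖ ^ 2))
          (ε * inner ℝ l w) 0 := by
        have h3 := (((((hasDerivAt_id (0 : ℝ)).const_mul 2).mul_const (inner ℝ l w)).const_add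
          (‖l‖ ^ 2)).add (((hasDerivAt_id (0 : ℝ)).pow 2).mul_const (‖w‖ ^ 2))).const_mul (ε / 2)
        refine h3.congr_deriv ?_
        simp
        ring
      exact (h1.sub hd).sub h2
    have hmax : IsLocalMax (fun s : ℝ => inner ℝ (l + s • w) t - Λ (l + s • w)
        - ε / 2 * (‖l‖ ^ 2 + 2 * s * inner ℝ l w + s ^ 2 * ‖w‖ ^ 2)) 0 := by
      refine Eventually.of_forall fun s => ?_
      have h1 := hl (l + s • w)
      rw [norm_add_sq_real, real_inner_smul_right, norm_smul, mul_pow, Real.norm_eq_abs,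
        sq_abs] at h1
      simp only [zero_smul, add_zero]
      calc _ = _ := by ring_nf
        _ ≤ _ := h1
        _ = _ := by ring
    have h0 := hmax.hasDerivAt_eq_zero hq
    refine hd.congr_deriv ?_
    rw [inner_sub_right, real_inner_smul_right, real_inner_comm l w]
    linarith
  · rw [inner_sub_right, real_inner_smul_right, real_inner_self_eq_norm_sq]
    have := hle l
    have h2 : 0 ≤ ε * ‖l‖ ^ 2 := by positivity
    linarith

end GartnerEllis

/-! ### From exponential bounds on probabilities to normalized extended logarithms. -/

section LogConversion

lemma inv_mul_log_le {ν α : ℝ} (hν : 0 < ν) {p : ENNReal}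
    (hp : p ≤ ENNReal.ofReal (Real.exp (ν * α))) :
    ((ν⁻¹ : ℝ) : EReal) * ENNReal.log p ≤ (α : EReal) := by
  have h1 : ENNReal.log p ≤ ((ν * α : ℝ) : EReal) := by
    refine (ENNReal.log_le_log hp).trans_eq ?_
    rw [ENNReal.log_ofReal_of_pos (Real.exp_pos _), Real.log_exp]
  calc ((ν⁻¹ : ℝ) : EReal) * ENNReal.log p ≤ ((ν⁻¹ : ℝ) : EReal) * ((ν * α : ℝ) : EReal) :=
        mul_le_mul_of_nonneg_left h1 (EReal.coe_nonneg.2 (inv_nonneg.2 hν.le))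
    _ = (α : EReal) := by
        rw [← EReal.coe_mul, inv_mul_cancel_left₀ hν.ne']

lemma le_inv_mul_log {ν α : ℝ} (hν : 0 < ν) {p : ENNReal}
    (hp : ENNReal.ofReal (Real.exp (ν * α)) ≤ p) :
    (α : EReal) ≤ ((ν⁻¹ : ℝ) : EReal) * ENNReal.log p := by
  have h1 : ((ν * α : ℝ) : EReal) ≤ ENNReal.log p := by
    refine le_trans (Eq.le ?_) (ENNReal.log_le_log hp)
    rw [ENNReal.log_ofReal_of_pos (Real.exp_pos _), Real.log_exp]
  calc (α : EReal) = ((ν⁻¹ : ℝ) : EReal) * ((ν * α : ℝ) : EReal) := by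
        rw [← EReal.coe_mul, inv_mul_cancel_left₀ hν.ne']
    _ ≤ _ := mul_le_mul_of_nonneg_left h1 (EReal.coe_nonneg.2 (inv_nonneg.2 hν.le))

variable {Ω : Type*} [MeasurableSpace Ω] {P : Measure Ω} [IsProbabilityMeasure P]
  {ν : ℕ → ℝ} {A : ℕ → Set Ω}

lemma limsup_inv_mul_log_le (hν : Tendsto ν atTop atTop) {I : EReal}
    (h : ∀ α : ℝ, (α : EReal) < I → ∀ᶠ n in atTop, P.real (A n) ≤ Real.exp (ν n * (-α))) :
    limsup (fun n => (((ν n)⁻¹ : ℝ) : EReal) * ENNReal.log (P (A n))) atTop ≤ -I := by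
  rw [EReal.le_neg]
  refine EReal.ge_of_forall_gt_iff_ge.1 fun α hα => ?_
  rw [EReal.le_neg]
  refine limsup_le_of_le (by isBoundedDefault) ?_
  filter_upwards [h α hα, hν.eventually_gt_atTop 0] with n hn hn0
  refine (inv_mul_log_le hn0 (α := -α) ?_).trans_eq (EReal.coe_neg α)
  rw [← ofReal_measureReal (μ := P) (s := A n)]
  exact ENNReal.ofReal_le_ofReal hn

lemma le_liminf_inv_mul_log (hν : Tendsto ν atTop atTop) {I : EReal}
    (h : ∀ α : ℝ, I < (α : EReal) → ∀ᶠ n in atTop, Real.exp (ν n * (-α)) ≤ P.real (A n)) :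
    -I ≤ liminf (fun n => (((ν n)⁻¹ : ℝ) : EReal) * ENNReal.log (P (A n))) atTop := by
  rw [EReal.neg_le]
  refine EReal.le_of_forall_lt_iff_le.1 fun α hα => ?_
  rw [EReal.neg_le]
  refine le_liminf_of_le (by isBoundedDefault) ?_
  filter_upwards [h α hα, hν.eventually_gt_atTop 0] with n hn hn0
  refine (EReal.coe_neg α).symm.trans_le (le_inv_mul_log hn0 (α := -α) ?_)
  rw [← ofReal_measureReal (μ := P) (s := A n)]
  exact ENNReal.ofReal_le_ofReal hn

end LogConversion

/-! ### Integrability, convergence and differentiability of `Ψ_x`. -/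

section KernelCumulants

/-- The Euclidean space in which the pair `(m_n, g_n)` takes its values. -/
abbrev PairSpace (q : ℕ) : Type := WithLp 2 (EuclideanSpace ℝ (Fin q) × ℝ)

/-- The embedding `y ↦ (y, 1)`. -/
def augment {q : ℕ} (y : EuclideanSpace ℝ (Fin q)) : PairSpace q := WithLp.toLp 2 (y, 1)

lemma inner_augment {q : ℕ} (l : PairSpace q) (y : EuclideanSpace ℝ (Fin q)) :
    inner ℝ l (augment y) = inner ℝ l.ofLp.1 y + l.ofLp.2 := by
  simp [augment, WithLp.prod_inner_apply]

lemma continuous_augment {q : ℕ} :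
    Continuous (augment : EuclideanSpace ℝ (Fin q) → PairSpace q) :=
  (WithLp.prod_continuous_toLp 2 _ _).comp (by fun_prop)

lemma norm_augment_le {q : ℕ} (y : EuclideanSpace ℝ (Fin q)) :
    ‖(augment y : PairSpace q)‖ ≤ ‖y‖ + 1 := by
  rw [augment, WithLp.prod_norm_eq_of_L2]
  refine Real.sqrt_le_iff.2 ⟨by positivity, ?_⟩
  have := norm_nonneg y
  simp
  nlinarith

/-- The factor `k` stays outside the exponential because, with `k = K z`, it alone provides
integrability over the infinite-measure variable `z`. -/
lemma abs_exp_mul_sub_one_le {a k C : ℝ} (hk : 0 ≤ k) (hkC : k ≤ C) :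
    |Real.exp (a * k) - 1| ≤ k * Real.exp ((C + 1) * |a|) := by
  have key : ∀ b : ℝ, |Real.exp b - 1| ≤ |b| * Real.exp |b| := by
    intro b
    rcases le_total 0 b with hb | hb
    · rw [abs_of_nonneg hb, abs_of_nonneg (by linarith [Real.add_one_le_exp b])]
      have h1 := Real.add_one_le_exp (-b)
      have h2 : Real.exp b * Real.exp (-b) = 1 := by rw [← Real.exp_add]; simp
      nlinarith [Real.exp_pos b]
    · rw [abs_of_nonpos hb, abs_of_nonpos (by linarith [Real.exp_le_one_iff.2 hb])]
      have h1 := Real.add_one_le_exp b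
      have h2 := Real.one_le_exp (neg_nonneg.2 hb)
      nlinarith
  have ha : |a| ≤ Real.exp |a| := by linarith [Real.add_one_le_exp |a|]
  calc |Real.exp (a * k) - 1| ≤ |a * k| * Real.exp |a * k| := key _
    _ = |a| * k * Real.exp (|a| * k) := by rw [abs_mul, abs_of_nonneg hk]
    _ ≤ Real.exp |a| * k * Real.exp (|a| * C) := by gcongr
    _ = k * Real.exp ((C + 1) * |a|) := by
        rw [mul_comm (Real.exp _) k, mul_assoc, ← Real.exp_add]; ring_nf

variable {d q : ℕ} {f : EuclideanSpace ℝ (Fin d) → EuclideanSpace ℝ (Fin q) → ℝ}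

/-- The function `e^{c‖y‖}` is dominated by finitely many exponentials `e^{⟨u, y⟩}`, so the bounds
assumed separately for each `u` give one for the norm, uniform in `t`. The term with `u = 0` covers
`y = 0`. -/
lemma exists_exp_norm_moment_bound (hf_meas : Measurable (Function.uncurry f))
    (hf_nonneg : ∀ t y, 0 ≤ f t y)
    (hf_fin : ∀ u t, Integrable (fun y => Real.exp (inner ℝ u y) * f t y))
    (hf_bdd : ∀ u, ∃ C : ℝ, ∀ t, ∫ y, Real.exp (inner ℝ u y) * f t y ≤ C) {c : ℝ} (hc : 0 ≤ c) :
    ∃ B : ℝ, ∀ t, Integrable (fun y => Real.exp (c * ‖(augment y : PairSpace q)‖) * f t y) ∧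
      ∫ y, Real.exp (c * ‖(augment y : PairSpace q)‖) * f t y ≤ B := by
  obtain ⟨W, hW⟩ := exists_finset_norm_le_inner (EuclideanSpace ℝ (Fin q))
  choose C hC using hf_bdd
  have hpt : ∀ t y, Real.exp (c * ‖(augment y : PairSpace q)‖) * f t y ≤ Real.exp c *
      (Real.exp (inner ℝ 0 y) * f t y + ∑ w ∈ W, Real.exp (inner ℝ (c • w) y) * f t y) := by
    intro t y
    have h0 : Real.exp (c * ‖(augment y : PairSpace q)‖) ≤ Real.exp c * Real.exp (c * ‖y‖) := by
      rw [← Real.exp_add]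
      refine Real.exp_le_exp.2 ?_
      have := mul_le_mul_of_nonneg_left (norm_augment_le y) hc
      linarith
    have h1 : Real.exp (c * ‖y‖) ≤
        Real.exp (inner ℝ 0 y) + ∑ w ∈ W, Real.exp (inner ℝ (c • w) y) := by
      by_cases hy : y = 0
      · subst hy
        simp
      · obtain ⟨w, hw, hwy⟩ := hW y hy
        have h2 : Real.exp (c * ‖y‖) ≤ Real.exp (inner ℝ (c • w) y) := by
          rw [real_inner_smul_left]
          gcongr
        have h3 := Finset.single_le_sum (f := fun w => Real.exp (inner ℝ (c • w) y))
          (fun _ _ => by positivity) hw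
        have h4 := Real.exp_pos (inner ℝ (0 : EuclideanSpace ℝ (Fin q)) y)
        linarith
    rw [← Finset.sum_mul, ← add_mul, ← mul_assoc]
    exact mul_le_mul_of_nonneg_right (h0.trans (by gcongr)) (hf_nonneg t y)
  have hint : ∀ t, Integrable (fun y => Real.exp c *
      (Real.exp (inner ℝ 0 y) * f t y + ∑ w ∈ W, Real.exp (inner ℝ (c • w) y) * f t y)) :=
    fun t => ((hf_fin 0 t).add (integrable_finsetSum _ fun w _ => hf_fin (c • w) t)).const_mul _
  refine ⟨Real.exp c * (C 0 + ∑ w ∈ W, C (c • w)), fun t => ?_⟩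
  have hi : Integrable (fun y => Real.exp (c * ‖(augment y : PairSpace q)‖) * f t y) := by
    refine (hint t).mono' ?_ (Eventually.of_forall fun y => ?_)
    · have h1 : Measurable (f t) := hf_meas.of_uncurry_left
      have h2 : Measurable fun y : EuclideanSpace ℝ (Fin q) =>
        Real.exp (c * ‖(augment y : PairSpace q)‖) := by
        have := continuous_augment (q := q)
        exact Continuous.measurable (by fun_prop)
      exact (h2.mul h1).aestronglyMeasurable
    · rw [Real.norm_of_nonneg (mul_nonneg (Real.exp_pos _).le (hf_nonneg t y))]
      exact hpt t y
  refine ⟨hi, (integral_mono hi (hint t) (hpt t)).trans ?_⟩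
  rw [integral_const_mul, integral_add (hf_fin 0 t)
    (integrable_finsetSum _ fun w _ => hf_fin (c • w) t),
    integral_finsetSum _ fun w _ => hf_fin (c • w) t]
  gcongr
  · exact hC _ _
  · exact hC _ _

/-- The integrand in the definition of `Ψ_x`, with the density evaluated at `t`. -/
noncomputable def psiIntegrand (f : EuclideanSpace ℝ (Fin d) → EuclideanSpace ℝ (Fin q) → ℝ)
    (l : PairSpace q) (k : ℝ) (t : EuclideanSpace ℝ (Fin d)) (y : EuclideanSpace ℝ (Fin q)) : ℝ :=
  (Real.exp (inner ℝ l (augment y) * k) - 1) * f t y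

lemma measurable_psiIntegrand {α : Type*} [MeasurableSpace α]
    (hf_meas : Measurable (Function.uncurry f)) (l : PairSpace q) {k : α → ℝ}
    {t : α → EuclideanSpace ℝ (Fin d)} {y : α → EuclideanSpace ℝ (Fin q)} (hk : Measurable k)
    (ht : Measurable t) (hy : Measurable y) :
    Measurable fun a => psiIntegrand f l (k a) (t a) (y a) := by
  have h1 : Measurable fun y : EuclideanSpace ℝ (Fin q) => inner ℝ l (augment y) := by
    have := continuous_augment (q := q)
    exact Continuous.measurable (by fun_prop)
  have h2 : Measurable fun a => f (t a) (y a) := hf_meas.comp (ht.prodMk hy)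
  unfold psiIntegrand
  exact (((h1.comp hy).mul hk).exp.sub_const 1).mul h2

lemma abs_psiIntegrand_le (hf_nonneg : ∀ t y, 0 ≤ f t y) (l : PairSpace q) {k C : ℝ} (hk : 0 ≤ k)
    (hkC : k ≤ C) (t : EuclideanSpace ℝ (Fin d)) (y : EuclideanSpace ℝ (Fin q)) :
    |psiIntegrand f l k t y| ≤
      k * (Real.exp ((C + 1) * ‖l‖ * ‖(augment y : PairSpace q)‖) * f t y) := by
  rw [psiIntegrand, abs_mul, abs_of_nonneg (hf_nonneg t y), ← mul_assoc]
  refine mul_le_mul_of_nonneg_right ?_ (hf_nonneg t y)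
  refine (abs_exp_mul_sub_one_le hk hkC).trans ?_
  rw [mul_assoc]
  have : 0 ≤ C + 1 := by linarith
  gcongr
  exact abs_real_inner_le_norm _ _

/-- A density with all exponential moments in the second variable, uniformly in the first. -/
structure HasUniformExpMoments
    (f : EuclideanSpace ℝ (Fin d) → EuclideanSpace ℝ (Fin q) → ℝ) : Prop where
  measurable : Measurable (Function.uncurry f)
  nonneg : ∀ t y, 0 ≤ f t y
  integrable : ∀ u t, Integrable (fun y => Real.exp (inner ℝ u y) * f t y)
  bounded : ∀ u, ∃ C : ℝ, ∀ t, ∫ y, Real.exp (inner ℝ u y) * f t y ≤ C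

/-- A measurable nonnegative integrable kernel bounded by `C`. -/
structure IsBoundedKernel (K : EuclideanSpace ℝ (Fin d) → ℝ) (C : ℝ) : Prop where
  measurable : Measurable K
  nonneg : ∀ z, 0 ≤ K z
  le : ∀ z, K z ≤ C
  integrable : Integrable K

variable {K : EuclideanSpace ℝ (Fin d) → ℝ} {C : ℝ}

lemma IsBoundedKernel.bound_nonneg (hK : IsBoundedKernel K C) : 0 ≤ C :=
  (hK.nonneg 0).trans (hK.le 0)

/-- Linearity in `k` and uniformity in `t` make `B * K z` an integrable majorant whatever the
bandwidth. -/
lemma exists_psiIntegrand_bound (hf : HasUniformExpMoments f) (hC : 0 ≤ C) (l : PairSpace q) :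
    ∃ B : ℝ, ∀ k t, 0 ≤ k → k ≤ C → Integrable (psiIntegrand f l k t) ∧
      ∫ y, ‖psiIntegrand f l k t y‖ ≤ k * B := by
  obtain ⟨B, hB⟩ := exists_exp_norm_moment_bound hf.measurable hf.nonneg hf.integrable hf.bounded
    (c := (C + 1) * ‖l‖) (by positivity)
  refine ⟨B, fun k t hk hkC => ?_⟩
  obtain ⟨h1, h2⟩ := hB t
  have hm : Measurable (psiIntegrand f l k t) := 
    measurable_psiIntegrand hf.measurable l measurable_const measurable_const measurable_id
  have hle := abs_psiIntegrand_le hf.nonneg l hk hkC t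
  have hi : Integrable (psiIntegrand f l k t) :=
    (h1.const_mul k).mono' hm.aestronglyMeasurable (Eventually.of_forall hle)
  refine ⟨hi, (integral_mono hi.norm (h1.const_mul k) hle).trans ?_⟩
  rw [integral_const_mul]
  gcongr

lemma integrable_psiIntegrand_comp (hf : HasUniformExpMoments f) (hC : 0 ≤ C) (l : PairSpace q)
    {k : EuclideanSpace ℝ (Fin d) → ℝ} {τ : EuclideanSpace ℝ (Fin d) → EuclideanSpace ℝ (Fin d)}
    (hk : Measurable k) (hk0 : ∀ z, 0 ≤ k z) (hkC : ∀ z, k z ≤ C) (hki : Integrable k)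
    (hτ : Measurable τ) :
    Integrable fun p : EuclideanSpace ℝ (Fin d) × EuclideanSpace ℝ (Fin q) =>
      psiIntegrand f l (k p.1) (τ p.1) p.2 := by
  obtain ⟨B, hB⟩ := exists_psiIntegrand_bound hf hC l
  have hm : Measurable fun p : EuclideanSpace ℝ (Fin d) × EuclideanSpace ℝ (Fin q) =>
      psiIntegrand f l (k p.1) (τ p.1) p.2 := 
    measurable_psiIntegrand hf.measurable l (hk.comp measurable_fst) (hτ.comp measurable_fst)
      measurable_snd
  rw [Measure.volume_eq_prod]
  refine (integrable_prod_iff hm.aestronglyMeasurable).2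
    ⟨Eventually.of_forall fun z => (hB (k z) (τ z) (hk0 z) (hkC z)).1, ?_⟩
  refine (hki.mul_const B).mono' ?_ (Eventually.of_forall fun z => ?_)
  · exact (hm.norm.stronglyMeasurable.integral_prod_right').aestronglyMeasurable
  · rw [Real.norm_of_nonneg (integral_nonneg fun y => norm_nonneg _)]
    exact (hB (k z) (τ z) (hk0 z) (hkC z)).2

/-- `Ψ_x` at scale `h`: the density is evaluated at `x - h z` instead of `x`. -/
noncomputable def scaledPsi (K : EuclideanSpace ℝ (Fin d) → ℝ)
    (f : EuclideanSpace ℝ (Fin d) → EuclideanSpace ℝ (Fin q) → ℝ) (x : EuclideanSpace ℝ (Fin d))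
    (h : ℝ) (l : PairSpace q) : ℝ :=
  ∫ z, ∫ y, psiIntegrand f l (K z) (x - h • z) y

lemma regPsi_eq_integral (x : EuclideanSpace ℝ (Fin d)) (l : PairSpace q) :
    regPsi K f x l.ofLp.1 l.ofLp.2 =
      ∫ p : EuclideanSpace ℝ (Fin d) × EuclideanSpace ℝ (Fin q), psiIntegrand f l (K p.1) x p.2 := by
  simp only [regPsi, psiIntegrand, inner_augment]

lemma regPsi_eq_scaledPsi (hf : HasUniformExpMoments f) (hK : IsBoundedKernel K C)
    (x : EuclideanSpace ℝ (Fin d)) (l : PairSpace q) :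
    regPsi K f x l.ofLp.1 l.ofLp.2 = scaledPsi K f x 0 l := by
  rw [regPsi_eq_integral, Measure.volume_eq_prod, integral_prod]
  · simp [scaledPsi]
  · exact integrable_psiIntegrand_comp hf hK.bound_nonneg l hK.measurable hK.nonneg hK.le
      hK.integrable measurable_const

lemma tendsto_scaledPsi (hf : HasUniformExpMoments f) (hK : IsBoundedKernel K C)
    {x : EuclideanSpace ℝ (Fin d)}
    (hf_cont : ∀ u, ContinuousAt (fun t => ∫ y, Real.exp (inner ℝ u y) * f t y) x)
    {h : ℕ → ℝ} (h_zero : Tendsto h atTop (𝓝 0)) (l : PairSpace q) :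
    Tendsto (fun n => scaledPsi K f x (h n) l) atTop (𝓝 (regPsi K f x l.ofLp.1 l.ofLp.2)) := by
  rw [regPsi_eq_scaledPsi hf hK]
  obtain ⟨B, hB⟩ := exists_psiIntegrand_bound hf hK.bound_nonneg l
  refine tendsto_integral_filter_of_dominated_convergence (fun z => K z * B) ?_ ?_
    (hK.integrable.mul_const B) ?_
  · refine Eventually.of_forall fun n => ?_
    have hKm := hK.measurable
    have hm : Measurable fun p : EuclideanSpace ℝ (Fin d) × EuclideanSpace ℝ (Fin q) =>
        psiIntegrand f l (K p.1) (x - h n • p.1) p.2 :=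
      measurable_psiIntegrand hf.measurable l (hKm.comp measurable_fst) (by fun_prop)
        measurable_snd
    exact hm.stronglyMeasurable.integral_prod_right'.aestronglyMeasurable
  · refine Eventually.of_forall fun n => Eventually.of_forall fun z => ?_
    exact (norm_integral_le_integral_norm _).trans (hB _ _ (hK.nonneg z) (hK.le z)).2
  · refine Eventually.of_forall fun z => ?_
    -- For fixed `z` the inner integral combines two functions of the family assumed continuous at
    -- `x`, with `u = K z • l.ofLp.1` and `u = 0`.
    have heq : ∀ t, ∫ y, psiIntegrand f l (K z) t y = Real.exp (l.ofLp.2 * K z) *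
        (∫ y, Real.exp (inner ℝ (K z • l.ofLp.1) y) * f t y) -
          ∫ y, Real.exp (inner ℝ 0 y) * f t y := by
      intro t
      rw [← integral_const_mul, ← integral_sub ((hf.integrable _ t).const_mul _)
        (hf.integrable 0 t)]
      refine integral_congr_ae (Eventually.of_forall fun y => ?_)
      simp only [psiIntegrand, inner_augment, real_inner_smul_left, inner_zero_left, Real.exp_zero]
      rw [← mul_assoc, ← Real.exp_add]
      ring_nf
    have hlim : Tendsto (fun n => x - h n • z) atTop (𝓝 x) := by
      have := (h_zero.smul_const z).const_sub x
      simpa using this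
    simp only [heq, zero_smul, sub_zero]
    exact (((hf_cont _).tendsto.comp hlim).const_mul _).sub ((hf_cont 0).tendsto.comp hlim)

lemma differentiable_regPsi (hf : HasUniformExpMoments f) (hK : IsBoundedKernel K C)
    (x : EuclideanSpace ℝ (Fin d)) :
    Differentiable ℝ fun l : PairSpace q => regPsi K f x l.ofLp.1 l.ofLp.2 := by
  intro l₀
  simp only [regPsi_eq_integral]
  have hC := hK.bound_nonneg
  have haug := continuous_augment (q := q)
  have hKm := hK.measurable
  have hfm : Measurable (f x) := hf.measurable.of_uncurry_left
  -- `(‖l₀‖ + 1) * C` bounds the exponent over the unit ball around `l₀`; the extra `1` absorbs the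
  -- factor `‖augment y‖` produced by differentiation.
  obtain ⟨B, hB⟩ := exists_exp_norm_moment_bound hf.measurable hf.nonneg hf.integrable hf.bounded
    (c := (‖l₀‖ + 1) * C + 1) (by positivity)
  have hint : ∀ l : PairSpace q, Integrable fun p : EuclideanSpace ℝ (Fin d) ×
      EuclideanSpace ℝ (Fin q) => psiIntegrand f l (K p.1) x p.2 := fun l =>
    integrable_psiIntegrand_comp hf hC l hK.measurable hK.nonneg hK.le hK.integrable
      measurable_const
  refine (hasFDerivAt_integral_of_dominated_of_fderiv_le (𝕜 := ℝ)
    (F' := fun l p => (Real.exp (inner ℝ l (augment p.2) * K p.1) * K p.1 * f x p.2) •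
      innerSL ℝ (augment p.2 : PairSpace q))
    (bound := fun p => K p.1 *
      (Real.exp (((‖l₀‖ + 1) * C + 1) * ‖(augment p.2 : PairSpace q)‖) * f x p.2))
    (Metric.ball_mem_nhds l₀ one_pos)
    (Eventually.of_forall fun l => (hint l).aestronglyMeasurable) (hint l₀) ?_ ?_ ?_
    ?_).differentiableAt
  · have h1 : Measurable fun p : EuclideanSpace ℝ (Fin d) × EuclideanSpace ℝ (Fin q) =>
        inner ℝ l₀ (augment p.2) := by
      exact Continuous.measurable (by fun_prop)
    have h2 : Measurable fun p : EuclideanSpace ℝ (Fin d) × EuclideanSpace ℝ (Fin q) =>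
        Real.exp (inner ℝ l₀ (augment p.2) * K p.1) * K p.1 * f x p.2 := by
      fun_prop
    have h3 : Continuous fun p : EuclideanSpace ℝ (Fin d) × EuclideanSpace ℝ (Fin q) =>
        innerSL ℝ (augment p.2 : PairSpace q) := by fun_prop
    exact h2.aestronglyMeasurable.smul h3.aestronglyMeasurable
  · refine Eventually.of_forall fun p l hl => ?_
    have hl' : ‖l‖ ≤ ‖l₀‖ + 1 := by
      have h1 : ‖l - l₀‖ < 1 := by simpa [dist_eq_norm] using hl
      have h2 := norm_sub_norm_le l l₀
      linarith
    have hk0 := hK.nonneg p.1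
    have hf0 := hf.nonneg x p.2
    set b := ‖(augment p.2 : PairSpace q)‖ with hb
    have hb0 : 0 ≤ b := norm_nonneg _
    rw [norm_smul, innerSL_apply_norm, ← hb, Real.norm_of_nonneg (by positivity)]
    have h1 : Real.exp (inner ℝ l (augment p.2) * K p.1) ≤ Real.exp ((‖l₀‖ + 1) * C * b) := by
      refine Real.exp_le_exp.2 ?_
      calc inner ℝ l (augment p.2) * K p.1 ≤ (‖l‖ * b) * K p.1 := by
            gcongr
            exact real_inner_le_norm _ _
        _ ≤ ((‖l₀‖ + 1) * b) * C := by
            gcongr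
            exact hK.le _
        _ = _ := by ring
    have h2 : b ≤ Real.exp b := by linarith [Real.add_one_le_exp b]
    calc _ ≤ Real.exp ((‖l₀‖ + 1) * C * b) * K p.1 * f x p.2 * Real.exp b := by gcongr
      _ = K p.1 * (Real.exp ((‖l₀‖ + 1) * C * b) * Real.exp b * f x p.2) := by ring
      _ = _ := by rw [← Real.exp_add]; ring_nf
  · exact hK.integrable.mul_prod (hB x).1
  · refine Eventually.of_forall fun p l _ => ?_
    have h1 : HasFDerivAt (fun l : PairSpace q => inner ℝ l (augment p.2))
        (innerSL ℝ (augment p.2 : PairSpace q)) l := by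
      refine (innerSL ℝ (augment p.2 : PairSpace q)).hasFDerivAt.congr_of_eventuallyEq ?_
      exact Eventually.of_forall fun l => real_inner_comm _ _
    have h2 := (((h1.mul_const (K p.1)).exp).sub_const 1).mul_const (f x p.2)
    refine h2.congr_fderiv ?_
    simp only [smul_smul]
    ring_nf

end KernelCumulants

/-! ### Cumulants of the pair `(m_n, g_n)`. -/

section EstimatorCumulants

/-- The contribution of one observation to `n h_n^d ⟨l, (m_n, g_n)⟩`. -/
noncomputable def kernelTerm {d q : ℕ} (K : EuclideanSpace ℝ (Fin d) → ℝ) (x : EuclideanSpace ℝ (Fin d))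
    (h : ℝ) (l : PairSpace q) (p : EuclideanSpace ℝ (Fin d) × EuclideanSpace ℝ (Fin q)) : ℝ :=
  inner ℝ l (augment p.2) * K (h⁻¹ • (x - p.1))

/-- The pair `(m_n(x), g_n(x))`. -/
noncomputable def kernelPair {Ω : Type*} {d q : ℕ} (K : EuclideanSpace ℝ (Fin d) → ℝ) (h : ℕ → ℝ)
    (X : ℕ → Ω → EuclideanSpace ℝ (Fin d)) (Y : ℕ → Ω → EuclideanSpace ℝ (Fin q))
    (x : EuclideanSpace ℝ (Fin d)) (n : ℕ) (ω : Ω) : PairSpace q :=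
  WithLp.toLp 2 (kernelM K h X Y x n ω, kernelG K h X x n ω)

lemma inner_kernelPair {Ω : Type*} {d q : ℕ} (K : EuclideanSpace ℝ (Fin d) → ℝ) (h : ℕ → ℝ)
    (X : ℕ → Ω → EuclideanSpace ℝ (Fin d)) (Y : ℕ → Ω → EuclideanSpace ℝ (Fin q))
    (x : EuclideanSpace ℝ (Fin d)) (l : PairSpace q) (n : ℕ) (ω : Ω) :
    inner ℝ l (kernelPair K h X Y x n ω) =
      ((n : ℝ) * h n ^ d)⁻¹ * ∑ i ∈ Finset.range n, kernelTerm K x (h n) l (X i ω, Y i ω) := by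
  have h1 : kernelPair K h X Y x n ω = ((n : ℝ) * h n ^ d)⁻¹ •
      ∑ i ∈ Finset.range n, K ((h n)⁻¹ • (x - X i ω)) • augment (Y i ω) := by
    rw [← (WithLp.linearEquiv 2 ℝ (EuclideanSpace ℝ (Fin q) × ℝ)).injective.eq_iff]
    ext1 <;> simp [kernelPair, kernelM, kernelG, augment, map_sum, Prod.fst_sum, Prod.snd_sum]
  rw [h1, real_inner_smul_right, inner_sum]
  simp only [kernelTerm, real_inner_smul_right, mul_comm]

variable {Ω : Type*} [MeasurableSpace Ω] {P : Measure Ω} {d q : ℕ}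
  {f : EuclideanSpace ℝ (Fin d) → EuclideanSpace ℝ (Fin q) → ℝ}
  {K : EuclideanSpace ℝ (Fin d) → ℝ} {C : ℝ} {x : EuclideanSpace ℝ (Fin d)}

lemma measurable_kernelTerm (hK : Measurable K) (h : ℝ) (l : PairSpace q) :
    Measurable (kernelTerm K x h l) := by
  have h1 : Measurable fun y : EuclideanSpace ℝ (Fin q) => inner ℝ l (augment y) := by
    have := continuous_augment (q := q)
    exact Continuous.measurable (by fun_prop)
  have h2 : Measurable fun t : EuclideanSpace ℝ (Fin d) => K (h⁻¹ • (x - t)) :=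
    hK.comp (by fun_prop)
  exact (h1.comp measurable_snd).mul (h2.comp measurable_fst)

/-- The substitution `t = x - h z` has Jacobian `h ^ d`; this is where the speed `n h_n^d`
originates. -/
lemma integral_psiIntegrand_eq_scaledPsi (hf : HasUniformExpMoments f) (hK : IsBoundedKernel K C)
    {h : ℝ} (hh : 0 < h) (l : PairSpace q) :
    (Integrable fun p : EuclideanSpace ℝ (Fin d) × EuclideanSpace ℝ (Fin q) =>
      psiIntegrand f l (K (h⁻¹ • (x - p.1))) p.1 p.2) ∧
    ∫ p : EuclideanSpace ℝ (Fin d) × EuclideanSpace ℝ (Fin q),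
      psiIntegrand f l (K (h⁻¹ • (x - p.1))) p.1 p.2 = h ^ d * scaledPsi K f x h l := by
  have hki : Integrable fun t => K (h⁻¹ • (x - t)) :=
    (hK.integrable.comp_smul (inv_ne_zero hh.ne')).comp_sub_left x
  have hint := integrable_psiIntegrand_comp hf hK.bound_nonneg l
    (hK.measurable.comp (by fun_prop : Measurable fun t => h⁻¹ • (x - t)))
    (fun _ => hK.nonneg _) (fun _ => hK.le _) hki measurable_id
  refine ⟨hint, ?_⟩
  have hFubini := integral_prod _ (Measure.volume_eq_prod (EuclideanSpace ℝ (Fin d))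
    (EuclideanSpace ℝ (Fin q)) ▸ hint)
  rw [← Measure.volume_eq_prod] at hFubini
  refine hFubini.trans ?_
  set k : EuclideanSpace ℝ (Fin d) → ℝ := fun t =>
    ∫ y, psiIntegrand f l (K (h⁻¹ • (x - t))) t y with hk
  have h1 : scaledPsi K f x h l = ∫ z, k (x - h • z) := by
    simp only [scaledPsi, hk, sub_sub_cancel, smul_smul, inv_mul_cancel₀ hh.ne', one_smul]
  have h2 : ∫ z, k (x - h • z) = |(h ^ d)⁻¹| * ∫ z, k z := by
    rw [Measure.integral_comp_smul volume (fun z => k (x - z)) h, integral_sub_left_eq_self k,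
      finrank_euclideanSpace_fin, smul_eq_mul]
  have hd : 0 < h ^ d := pow_pos hh d
  rw [h1, h2, abs_of_pos (inv_pos.2 hd), mul_inv_cancel_left₀ hd.ne']
  rfl

lemma integrable_exp_kernelTerm [IsProbabilityMeasure P] (hf : HasUniformExpMoments f)
    (hK : IsBoundedKernel K C) {X : Ω → EuclideanSpace ℝ (Fin d)} {Y : Ω → EuclideanSpace ℝ (Fin q)}
    (hX : Measurable X) (hY : Measurable Y)
    (h_law : P.map (fun ω => (X ω, Y ω)) =
      (volume : Measure (EuclideanSpace ℝ (Fin d) × EuclideanSpace ℝ (Fin q))).withDensity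
        (fun p => ENNReal.ofReal (f p.1 p.2)))
    {h : ℝ} (hh : 0 < h) (l : PairSpace q) :
    Integrable (fun ω => Real.exp (kernelTerm K x h l (X ω, Y ω))) P ∧
      ∫ ω, Real.exp (kernelTerm K x h l (X ω, Y ω)) ∂P = 1 + h ^ d * scaledPsi K f x h l := by
  obtain ⟨h1, h2⟩ := integral_psiIntegrand_eq_scaledPsi (x := x) hf hK hh l
  have hm := measurable_kernelTerm (x := x) hK.measurable h l
  have hφ : Measurable fun p => Real.exp (kernelTerm K x h l p) - 1 := hm.exp.sub_const 1
  have hXY : Measurable fun ω => (X ω, Y ω) := hX.prodMk hY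
  have hfm : Measurable fun p : EuclideanSpace ℝ (Fin d) × EuclideanSpace ℝ (Fin q) =>
      ENNReal.ofReal (f p.1 p.2) := hf.measurable.ennreal_ofReal
  have hfin : ∀ᵐ p : EuclideanSpace ℝ (Fin d) × EuclideanSpace ℝ (Fin q),
      ENNReal.ofReal (f p.1 p.2) < ⊤ := Eventually.of_forall fun _ => ENNReal.ofReal_lt_top
  have heq : (fun p : EuclideanSpace ℝ (Fin d) × EuclideanSpace ℝ (Fin q) =>
      (ENNReal.ofReal (f p.1 p.2)).toReal • (Real.exp (kernelTerm K x h l p) - 1)) =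
      fun p => psiIntegrand f l (K (h⁻¹ • (x - p.1))) p.1 p.2 := by
    ext p
    rw [ENNReal.toReal_ofReal (hf.nonneg _ _), smul_eq_mul, mul_comm]
    rfl
  have hi : Integrable (fun ω => Real.exp (kernelTerm K x h l (X ω, Y ω)) - 1) P := by
    have : Integrable (fun p => Real.exp (kernelTerm K x h l p) - 1)
        (P.map fun ω => (X ω, Y ω)) := by
      rw [h_law, integrable_withDensity_iff_integrable_smul' hfm hfin, heq]
      exact h1
    exact this.comp_measurable hXY
  have hv : ∫ ω, (Real.exp (kernelTerm K x h l (X ω, Y ω)) - 1) ∂P =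
      h ^ d * scaledPsi K f x h l := by
    rw [← h2, ← heq, ← integral_withDensity_eq_integral_toReal_smul hfm hfin, ← h_law,
      integral_map hXY.aemeasurable hφ.aestronglyMeasurable]
  have hi' : Integrable (fun ω => Real.exp (kernelTerm K x h l (X ω, Y ω))) P := by
    refine (hi.add (integrable_const (1 : ℝ))).congr (Eventually.of_forall fun ω => ?_)
    simp
  refine ⟨hi', ?_⟩
  rw [integral_sub hi' (integrable_const _)] at hv
  simp at hv
  linarith

variable {X : ℕ → Ω → EuclideanSpace ℝ (Fin d)} {Y : ℕ → Ω → EuclideanSpace ℝ (Fin q)} {h : ℕ → ℝ}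

lemma measurable_kernelPair (hK : Measurable K) (hX : ∀ i, Measurable (X i))
    (hY : ∀ i, Measurable (Y i)) (n : ℕ) : Measurable (kernelPair K h X Y x n) := by
  have hKX : ∀ i, Measurable fun ω => K ((h n)⁻¹ • (x - X i ω)) := fun i => by
    have := hX i
    exact hK.comp (by fun_prop)
  have h1 : Measurable fun ω => (kernelM K h X Y x n ω, kernelG K h X x n ω) := by
    unfold kernelM kernelG
    refine Measurable.prodMk ?_ ?_
    · exact (Finset.measurable_sum _ fun i _ => (hKX i).smul (hY i)).const_smul (((n : ℝ) * h n ^ d)⁻¹)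
    · exact (Finset.measurable_sum _ fun i _ => hKX i).const_mul _
  exact (WithLp.measurable_toLp 2 _).comp h1

/-- Multiplying by the speed cancels the normalization of the pair, leaving a sum of `n` i.i.d.
terms whose moment generating functions multiply. -/
lemma exp_kernelPair [IsProbabilityMeasure P] (hf : HasUniformExpMoments f)
    (hK : IsBoundedKernel K C) (hX : ∀ i, Measurable (X i)) (hY : ∀ i, Measurable (Y i))
    (h_indep : iIndepFun (fun i ω => (X i ω, Y i ω)) P)
    (h_law : ∀ i, P.map (fun ω => (X i ω, Y i ω)) =
      (volume : Measure (EuclideanSpace ℝ (Fin d) × EuclideanSpace ℝ (Fin q))).withDensity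
        (fun p => ENNReal.ofReal (f p.1 p.2)))
    (h_pos : ∀ n, 1 ≤ n → 0 < h n) (l : PairSpace q) {n : ℕ} (hn : 1 ≤ n) :
    Integrable (fun ω => Real.exp
      ((n : ℝ) * h n ^ d * inner ℝ l (kernelPair K h X Y x n ω))) P ∧
    cgf (fun ω => inner ℝ l (kernelPair K h X Y x n ω)) P ((n : ℝ) * h n ^ d) =
      n * Real.log (1 + h n ^ d * scaledPsi K f x (h n) l) := by
  have hh := h_pos n hn
  have hν : (n : ℝ) * h n ^ d ≠ 0 := by positivity
  set T : ℕ → Ω → ℝ := fun i ω => kernelTerm K x (h n) l (X i ω, Y i ω) with hT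
  have hTm : ∀ i, Measurable (T i) := fun i =>
    (measurable_kernelTerm hK.measurable _ l).comp ((hX i).prodMk (hY i))
  have hTi : iIndepFun T P :=
    h_indep.comp (fun _ => kernelTerm K x (h n) l) fun _ => measurable_kernelTerm hK.measurable _ l
  have hexp : ∀ i, Integrable (fun ω => Real.exp (1 * T i ω)) P ∧
      mgf (T i) P 1 = 1 + h n ^ d * scaledPsi K f x (h n) l := by
    intro i
    simpa [mgf] using integrable_exp_kernelTerm hf hK (hX i) (hY i) (h_law i) hh l
  have heq : ∀ ω, (n : ℝ) * h n ^ d * inner ℝ l (kernelPair K h X Y x n ω) =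
      1 * (∑ i ∈ Finset.range n, T i) ω := by
    intro ω
    rw [inner_kernelPair, mul_inv_cancel_left₀ hν, one_mul, Finset.sum_apply]
  constructor
  · simp only [heq]
    exact hTi.integrable_exp_mul_sum hTm fun i _ => (hexp i).1
  · have : mgf (fun ω => inner ℝ l (kernelPair K h X Y x n ω)) P ((n : ℝ) * h n ^ d) =
        mgf (∑ i ∈ Finset.range n, T i) P 1 := by
      simp only [mgf, heq]
    rw [cgf, this, hTi.mgf_sum hTm, Finset.prod_congr rfl fun i _ => (hexp i).2]
    simp

/-- The limit of the normalized cumulant generating functions of `(m_n, g_n)`. -/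
lemma tendsto_cgf_kernelPair [IsProbabilityMeasure P] (hf : HasUniformExpMoments f)
    (hK : IsBoundedKernel K C) (hX : ∀ i, Measurable (X i)) (hY : ∀ i, Measurable (Y i))
    (h_indep : iIndepFun (fun i ω => (X i ω, Y i ω)) P)
    (h_law : ∀ i, P.map (fun ω => (X i ω, Y i ω)) =
      (volume : Measure (EuclideanSpace ℝ (Fin d) × EuclideanSpace ℝ (Fin q))).withDensity
        (fun p => ENNReal.ofReal (f p.1 p.2)))
    (h_pos : ∀ n, 1 ≤ n → 0 < h n) (h_zero : Tendsto h atTop (𝓝 0)) (hd : d ≠ 0)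
    (hf_cont : ∀ u, ContinuousAt (fun t => ∫ y, Real.exp (inner ℝ u y) * f t y) x)
    (l : PairSpace q) :
    Tendsto (fun n : ℕ => ((n : ℝ) * h n ^ d)⁻¹ *
      cgf (fun ω => inner ℝ l (kernelPair K h X Y x n ω)) P ((n : ℝ) * h n ^ d)) atTop
      (𝓝 (regPsi K f x l.ofLp.1 l.ofLp.2)) := by
  have hψ := tendsto_scaledPsi hf hK hf_cont h_zero l
  -- In dimension zero this would fail, since `h n ^ 0 = 1`.
  have hhd : Tendsto (fun n => h n ^ d) atTop (𝓝 0) := by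
    simpa [hd] using h_zero.pow d
  have hden : Tendsto (fun n => 1 + h n ^ d * scaledPsi K f x (h n) l) atTop (𝓝 1) := by
    simpa using (hhd.mul hψ).const_add 1
  -- The squeeze comes from `1 - w⁻¹ ≤ log w ≤ w - 1` at `w = 1 + h n ^ d * scaledPsi K f x (h n)
  -- l`, divided by `h n ^ d`.
  have hlow : Tendsto (fun n => scaledPsi K f x (h n) l / (1 + h n ^ d * scaledPsi K f x (h n) l))
      atTop (𝓝 (regPsi K f x l.ofLp.1 l.ofLp.2)) := by
    have := hψ.div hden one_ne_zero
    rwa [div_one] at this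
  have hev : ∀ᶠ n : ℕ in atTop, 1 ≤ n ∧ 0 < 1 + h n ^ d * scaledPsi K f x (h n) l :=
    (eventually_ge_atTop 1).and (hden.eventually (lt_mem_nhds one_pos))
  have hval : ∀ n : ℕ, 1 ≤ n → ((n : ℝ) * h n ^ d)⁻¹ *
      cgf (fun ω => inner ℝ l (kernelPair K h X Y x n ω)) P ((n : ℝ) * h n ^ d) =
      (h n ^ d)⁻¹ * Real.log (1 + h n ^ d * scaledPsi K f x (h n) l) := by
    intro n hn
    rw [(exp_kernelPair hf hK hX hY h_indep h_law h_pos l hn).2]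
    have : (n : ℝ) ≠ 0 := by positivity
    field_simp
  refine tendsto_of_tendsto_of_tendsto_of_le_of_le' hlow hψ ?_ ?_
  · filter_upwards [hev] with n ⟨hn, hpos⟩
    have hhn : 0 < h n ^ d := pow_pos (h_pos n hn) d
    rw [hval n hn, inv_mul_eq_div, le_div_iff₀ hhn]
    refine le_trans (Eq.le ?_) (Real.one_sub_inv_le_log_of_pos hpos)
    rw [eq_sub_iff_add_eq, div_mul_eq_mul_div, inv_eq_one_div, ← add_div, div_eq_one_iff_eq hpos.ne']
    ring
  · filter_upwards [hev] with n ⟨hn, hpos⟩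
    have hhn : 0 < h n ^ d := pow_pos (h_pos n hn) d
    rw [hval n hn, inv_mul_eq_div, div_le_iff₀ hhn]
    have := Real.log_le_sub_one_of_pos hpos
    linarith

end EstimatorCumulants

/-! ### The rate functions `I_x` and `J`. -/

section RateFunction

variable {d q : ℕ} {f : EuclideanSpace ℝ (Fin d) → EuclideanSpace ℝ (Fin q) → ℝ}
  {K : EuclideanSpace ℝ (Fin d) → ℝ} {C : ℝ} {x : EuclideanSpace ℝ (Fin d)}

lemma regI_eq_legendre (K : EuclideanSpace ℝ (Fin d) → ℝ)
    (f : EuclideanSpace ℝ (Fin d) → EuclideanSpace ℝ (Fin q) → ℝ) (x : EuclideanSpace ℝ (Fin d))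
    (p : PairSpace q) :
    regI K f x p.ofLp.1 p.ofLp.2 =
      legendre (fun l : PairSpace q => regPsi K f x l.ofLp.1 l.ofLp.2) p := by
  have h : ∀ l : PairSpace q, inner ℝ l p = inner ℝ l.ofLp.1 p.ofLp.1 + l.ofLp.2 * p.ofLp.2 := by
    intro l
    rw [WithLp.prod_inner_apply]
    simp [mul_comm]
  refine le_antisymm (iSup₂_le fun u v => ?_) (iSup_le fun l => ?_)
  · refine le_trans (Eq.le ?_) (le_legendre _ p (WithLp.toLp 2 (u, v)))
    rw [h]
  · rw [h]
    exact le_iSup₂ (f := fun u v =>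
      ((inner ℝ u p.ofLp.1 + v * p.ofLp.2 - regPsi K f x u v : ℝ) : EReal)) l.ofLp.1 l.ofLp.2

lemma regPsi_zero (K : EuclideanSpace ℝ (Fin d) → ℝ)
    (f : EuclideanSpace ℝ (Fin d) → EuclideanSpace ℝ (Fin q) → ℝ) (x : EuclideanSpace ℝ (Fin d)) :
    regPsi K f x 0 0 = 0 := by
  simp [regPsi]

/-- As the kernel charges a set of infinite measure, `Ψ_x(0, v) → -∞` as `v → -∞`. -/
lemma exists_regPsi_zero_le (hK : IsBoundedKernel K C) (hK_supp : volume {z | 0 < K z} = ⊤)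
    (hg : 0 < ∫ y, f x y) (M : ℝ) : ∃ m : ℝ, 0 ≤ m ∧ regPsi K f x 0 (-m) ≤ -M := by
  set g := ∫ y, f x y with hgdef
  set c : ℝ := 1 - Real.exp (-1) with hc
  have hc0 : 0 < c := by
    have : Real.exp (-1) < 1 := by simp
    rw [hc]; linarith
  -- These sets increase to `{K > 0}`, so their measures tend to infinity, while `1 - e^{-mK}` is at
  -- least `c` on `S m`. Markov's inequality then makes `-Ψ_x(0, -m)` as large as desired.
  let S : ℕ → Set (EuclideanSpace ℝ (Fin d)) := fun m => {z | 1 ≤ (m : ℝ) * K z}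
  have hmono : Monotone S := by
    intro a b hab z hz
    have h1 : (1 : ℝ) ≤ a * K z := hz
    have h2 : (a : ℝ) * K z ≤ b * K z :=
      mul_le_mul_of_nonneg_right (Nat.cast_le.2 hab) (hK.nonneg z)
    exact h1.trans h2
  have hUnion : ⋃ m, S m = {z | 0 < K z} := by
    ext z
    simp only [S, Set.mem_iUnion, Set.mem_ofPred_eq]
    constructor
    · rintro ⟨m, hm⟩
      refine lt_of_le_of_ne (hK.nonneg z) fun h0 => ?_
      rw [← h0, mul_zero] at hm
      linarith
    · intro hz
      obtain ⟨m, hm⟩ := exists_nat_ge (1 / K z)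
      exact ⟨m, (div_le_iff₀ hz).1 hm⟩
  have hlim := tendsto_measure_iUnion_atTop (μ := volume) hmono
  rw [hUnion, hK_supp] at hlim
  obtain ⟨m, hm⟩ := (hlim.eventually
    (lt_mem_nhds (ENNReal.ofReal_lt_top (r := |M| / (c * g))))).exists
  have hint : Integrable fun z => 1 - Real.exp (-(m : ℝ) * K z) := by
    have hKm := hK.measurable
    refine (hK.integrable.const_mul (m : ℝ)).mono'
      (by fun_prop : Measurable fun z => 1 - Real.exp (-(m : ℝ) * K z)).aestronglyMeasurable
      (Eventually.of_forall fun z => ?_)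
    have h0 : 0 ≤ (m : ℝ) * K z := mul_nonneg (Nat.cast_nonneg m) (hK.nonneg z)
    have h1 : Real.exp (-(m : ℝ) * K z) ≤ 1 := Real.exp_le_one_iff.2 (by linarith)
    have h2 := Real.add_one_le_exp (-(m : ℝ) * K z)
    rw [Real.norm_of_nonneg (by linarith)]
    linarith
  have hnn : 0 ≤ fun z => 1 - Real.exp (-(m : ℝ) * K z) := fun z => by
    have h0 : 0 ≤ (m : ℝ) * K z := mul_nonneg (Nat.cast_nonneg m) (hK.nonneg z)
    have h1 : Real.exp (-(m : ℝ) * K z) ≤ 1 := Real.exp_le_one_iff.2 (by linarith)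
    simpa using h1
  have hmarkov := mul_meas_ge_le_integral_of_nonneg (Eventually.of_forall hnn) hint c
  have hset : {z | c ≤ 1 - Real.exp (-(m : ℝ) * K z)} = S m := by
    ext z
    simp only [hc, S, Set.mem_ofPred_eq, sub_le_sub_iff_left, Real.exp_le_exp]
    constructor <;> intro h <;> linarith
  rw [hset] at hmarkov
  have hfinite : volume (S m) ≠ ⊤ := by
    have := hint.measure_ge_lt_top hc0
    rw [hset] at this
    exact this.ne
  have hvol : |M| / (c * g) ≤ volume.real (S m) :=
    (ENNReal.ofReal_le_iff_le_toReal hfinite).1 hm.le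
  have hpsi : regPsi K f x 0 (-(m : ℝ)) = -((∫ z, (1 - Real.exp (-(m : ℝ) * K z))) * g) := by
    rw [hgdef, ← integral_prod_mul, ← integral_neg, regPsi, Measure.volume_eq_prod]
    congr 1
    ext p
    simp only [inner_zero_left, zero_add]
    ring
  refine ⟨m, Nat.cast_nonneg m, ?_⟩
  rw [hpsi, neg_le_neg_iff]
  calc M ≤ |M| := le_abs_self M
    _ = c * (|M| / (c * g)) * g := by field_simp
    _ ≤ c * volume.real (S m) * g := by gcongr
    _ ≤ _ := by gcongr

/-- Testing with `(0, -m)` gives `-m * t₂ - Ψ_x(0, -m)`, where the first term is nonnegative and the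
second is unbounded above in `m`. -/
lemma regI_eq_top (hK : IsBoundedKernel K C) (hK_supp : volume {z | 0 < K z} = ⊤)
    (hg : 0 < ∫ y, f x y) (t₁ : EuclideanSpace ℝ (Fin q)) {t₂ : ℝ} (ht : t₂ ≤ 0) :
    regI K f x t₁ t₂ = ⊤ := by
  refine (EReal.eq_top_iff_forall_lt _).2 fun M => ?_
  obtain ⟨m, hm, hM⟩ := exists_regPsi_zero_le (f := f) (x := x) hK hK_supp hg (M + 1)
  refine lt_of_lt_of_le ?_ (le_iSup₂ (f := fun u v =>
      ((inner ℝ u t₁ + v * t₂ - regPsi K f x u v : ℝ) : EReal)) 0 (-m))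
  rw [EReal.coe_lt_coe_iff, inner_zero_left]
  nlinarith [mul_nonneg hm (neg_nonneg.2 ht)]

/-- The quotient map `(a, t) ↦ a / t`. -/
noncomputable def pairRatio {q : ℕ} (p : PairSpace q) : EuclideanSpace ℝ (Fin q) :=
  p.ofLp.2⁻¹ • p.ofLp.1

lemma continuousOn_pairRatio : ContinuousOn (pairRatio (q := q)) {p | 0 < p.ofLp.2} := by
  have h1 : Continuous fun p : PairSpace q => p.ofLp := WithLp.prod_continuous_ofLp 2 _ _
  exact ContinuousOn.smul (h1.snd.continuousOn.inv₀ fun p hp => ne_of_gt hp) h1.fst.continuousOn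

lemma isOpen_pos_snd : IsOpen {p : PairSpace q | 0 < p.ofLp.2} := by
  have h1 : Continuous fun p : PairSpace q => p.ofLp := WithLp.prod_continuous_ofLp 2 _ _
  exact isOpen_lt continuous_const h1.snd

lemma smul_pairRatio {p : PairSpace q} (hp : 0 < p.ofLp.2) :
    p.ofLp.2 • pairRatio p = p.ofLp.1 := by
  rw [pairRatio, smul_inv_smul₀ hp.ne']

lemma pairRatio_smul {t : ℝ} (ht : 0 < t) (s : EuclideanSpace ℝ (Fin q)) :
    pairRatio (WithLp.toLp 2 (t • s, t)) = s := by
  simp [pairRatio, inv_smul_smul₀ ht.ne']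

lemma regJ_pairRatio_le {p : PairSpace q} (hp : 0 < p.ofLp.2) :
    regJ K f x (pairRatio p) ≤ regI K f x p.ofLp.1 p.ofLp.2 := by
  refine (iInf_le _ p.ofLp.2).trans_eq ?_
  rw [smul_pairRatio hp]

/-- A `t` with finite cost in the infimum defining `J` is automatically positive, so `s` is a
genuine quotient. -/
lemma exists_regI_lt (hK : IsBoundedKernel K C) (hK_supp : volume {z | 0 < K z} = ⊤)
    (hg : 0 < ∫ y, f x y) {s : EuclideanSpace ℝ (Fin q)} {α : EReal} (hα : regJ K f x s < α) :
    ∃ p : PairSpace q, 0 < p.ofLp.2 ∧ pairRatio p = s ∧ regI K f x p.ofLp.1 p.ofLp.2 < α := by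
  obtain ⟨t, ht⟩ := iInf_lt_iff.1 hα
  have ht0 : 0 < t := by
    by_contra h
    rw [regI_eq_top hK hK_supp hg _ (not_lt.1 h)] at ht
    exact not_top_lt ht
  exact ⟨WithLp.toLp 2 (t • s, t), ht0, pairRatio_smul ht0 s, ht⟩

lemma regJ_nonneg (s : EuclideanSpace ℝ (Fin q)) : 0 ≤ regJ K f x s := by
  refine le_iInf fun t => le_trans (Eq.le ?_) (le_iSup₂ (f := fun u v =>
      ((inner ℝ u (t • s) + v * t - regPsi K f x u v : ℝ) : EReal)) 0 0)
  simp [regPsi_zero]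

lemma isCompact_regJ_le (hK : IsBoundedKernel K C) (hK_supp : volume {z | 0 < K z} = ⊤)
    (hg : 0 < ∫ y, f x y) (α : ℝ) :
    IsCompact {s : EuclideanSpace ℝ (Fin q) | regJ K f x s ≤ (α : EReal)} := by
  set L : ℝ → Set (PairSpace q) := fun β => {p | regI K f x p.ofLp.1 p.ofLp.2 ≤ (β : EReal)}
    with hL
  have hLpos : ∀ β, L β ⊆ {p | 0 < p.ofLp.2} := by
    intro β p hp
    by_contra h
    have h1 : regI K f x p.ofLp.1 p.ofLp.2 ≤ (β : EReal) := hp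
    rw [regI_eq_top hK hK_supp hg _ (not_lt.1 h)] at h1
    exact EReal.coe_ne_top β (top_le_iff.1 h1)
  have hLc : ∀ β, IsCompact (pairRatio '' L β) := by
    intro β
    refine IsCompact.image_of_continuousOn ?_ (continuousOn_pairRatio.mono (hLpos β))
    simp only [hL, regI_eq_legendre]
    exact isCompact_legendre_le _ β
  -- Intersecting over `β > α` avoids having to show that the infimum over `t` is attained.
  have heq : {s : EuclideanSpace ℝ (Fin q) | regJ K f x s ≤ (α : EReal)} =
      ⋂ β ∈ Set.Ioi α, pairRatio '' L β := by
    ext s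
    simp only [Set.mem_ofPred_eq, Set.mem_iInter, Set.mem_Ioi]
    constructor
    · intro hs β hβ
      obtain ⟨p, -, hps, hp⟩ := exists_regI_lt hK hK_supp hg
        (hs.trans_lt (EReal.coe_lt_coe_iff.2 hβ))
      exact ⟨p, hp.le, hps⟩
    · intro hs
      refine EReal.le_of_forall_lt_iff_le.1 fun β hβ => ?_
      obtain ⟨p, hp, rfl⟩ := hs β (EReal.coe_lt_coe_iff.1 hβ)
      exact (regJ_pairRatio_le (hLpos β hp)).trans hp
  rw [heq]
  refine (hLc (α + 1)).of_isClosed_subset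
    (isClosed_biInter fun β _ => (hLc β).isClosed)
    (Set.biInter_subset_of_mem (by simp))

lemma isGoodRateFunction_regJ (hK : IsBoundedKernel K C) (hK_supp : volume {z | 0 < K z} = ⊤)
    (hg : 0 < ∫ y, f x y) : IsGoodRateFunction (regJ K f x) := by
  have hcpt := isCompact_regJ_le (f := f) (x := x) hK hK_supp hg
  refine ⟨⟨regJ_nonneg, ?_⟩, hcpt⟩
  refine lowerSemicontinuous_iff_isClosed_preimage.2 fun α => ?_
  induction α with
  | bot =>
    convert isClosed_empty
    ext s
    simp only [Set.mem_preimage, Set.mem_Iic, le_bot_iff, Set.mem_empty_iff_false, iff_false]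
    intro h
    exact absurd (h ▸ regJ_nonneg s) (by simp)
  | coe a => exact (hcpt a).isClosed
  | top => simp

end RateFunction

/-! ### Transfer to the quotient, and independence of the version of the kernel. -/

section Deviations

variable {Ω : Type*} [MeasurableSpace Ω] {P : Measure Ω} {d q : ℕ}
  {f : EuclideanSpace ℝ (Fin d) → EuclideanSpace ℝ (Fin q) → ℝ}
  {K K' : EuclideanSpace ℝ (Fin d) → ℝ} {C : ℝ} {x : EuclideanSpace ℝ (Fin d)}
  {X : ℕ → Ω → EuclideanSpace ℝ (Fin d)} {Y : ℕ → Ω → EuclideanSpace ℝ (Fin q)} {h : ℕ → ℝ}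

/-- When `g_n = 0`, the convention `0⁻¹ = 0` reproduces the default value `0` of the estimator. -/
lemma nadarayaWatson_eq_pairRatio {Ω : Type*} (K : EuclideanSpace ℝ (Fin d) → ℝ) (h : ℕ → ℝ)
    (X : ℕ → Ω → EuclideanSpace ℝ (Fin d)) (Y : ℕ → Ω → EuclideanSpace ℝ (Fin q))
    (x : EuclideanSpace ℝ (Fin d)) (n : ℕ) (ω : Ω) :
    nadarayaWatson K h X Y x n ω = pairRatio (kernelPair K h X Y x n ω) := by
  by_cases hg : kernelG K h X x n ω = 0 <;> simp [nadarayaWatson, pairRatio, kernelPair, hg]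

lemma dimension_ne_zero_of_measure_eq_top {s : Set (EuclideanSpace ℝ (Fin d))}
    (hs : volume s = ⊤) : d ≠ 0 := by
  rintro rfl
  exact (s.toFinite.isCompact.measure_lt_top (μ := volume)).ne hs

theorem satisfiesLDP_nadarayaWatson [IsProbabilityMeasure P] (hf : HasUniformExpMoments f)
    (hK : IsBoundedKernel K C) (hX : ∀ i, Measurable (X i)) (hY : ∀ i, Measurable (Y i))
    (h_indep : iIndepFun (fun i ω => (X i ω, Y i ω)) P)
    (h_law : ∀ i, P.map (fun ω => (X i ω, Y i ω)) =
      (volume : Measure (EuclideanSpace ℝ (Fin d) × EuclideanSpace ℝ (Fin q))).withDensity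
        (fun p => ENNReal.ofReal (f p.1 p.2)))
    (h_pos : ∀ n, 1 ≤ n → 0 < h n) (h_zero : Tendsto h atTop (𝓝 0))
    (h_infty : Tendsto (fun n : ℕ => (n : ℝ) * h n ^ d) atTop atTop)
    (hK_supp : volume {z | 0 < K z} = ⊤) (hg : 0 < ∫ y, f x y)
    (hf_cont : ∀ u, ContinuousAt (fun t => ∫ y, Real.exp (inner ℝ u y) * f t y) x) :
    SatisfiesLDP P (fun n => nadarayaWatson K h X Y x n) (fun n => (n : ℝ) * h n ^ d)
      (regJ K f x) := by
  have hd := dimension_ne_zero_of_measure_eq_top hK_supp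
  have hint : ∀ l : PairSpace q, ∀ᶠ n : ℕ in atTop, Integrable (fun ω => Real.exp
      ((n : ℝ) * h n ^ d * inner ℝ l (kernelPair K h X Y x n ω))) P := fun l =>
    (eventually_ge_atTop 1).mono fun n hn =>
      (exp_kernelPair hf hK hX hY h_indep h_law h_pos l hn).1
  have hlim := tendsto_cgf_kernelPair hf hK hX hY h_indep h_law h_pos h_zero hd hf_cont
  refine ⟨⟨fun n hn => ?_, h_infty⟩, (isGoodRateFunction_regJ hK hK_supp hg).1,
    fun U hU => ?_, fun V hV => ?_⟩
  · have := h_pos n hn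
    positivity
  · refine le_liminf_inv_mul_log h_infty fun α hα => ?_
    obtain ⟨s, hs⟩ := iInf_lt_iff.1 hα
    obtain ⟨hsU, hs⟩ := iInf_lt_iff.1 hs
    obtain ⟨p, hp, rfl, hpα⟩ := exists_regI_lt hK hK_supp hg hs
    rw [regI_eq_legendre] at hpα
    have hG : IsOpen ({p : PairSpace q | 0 < p.ofLp.2} ∩ pairRatio ⁻¹' U) :=
      continuousOn_pairRatio.isOpen_inter_preimage isOpen_pos_snd hU
    have hlow := gartnerEllis_lower h_infty (measurable_kernelPair hK.measurable hX hY) hint hlim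
      (differentiable_regPsi hf hK x) (regPsi_zero K f x) hG ⟨hp, hsU⟩ hpα
    filter_upwards [hlow] with n hn
    refine hn.trans (measureReal_mono fun ω hω => ?_)
    have h2 : pairRatio (kernelPair K h X Y x n ω) ∈ U := hω.2
    rwa [← nadarayaWatson_eq_pairRatio] at h2
  · refine limsup_inv_mul_log_le h_infty fun α hα => ?_
    -- The preimage of `V` is enlarged by the whole half-space `t ≤ 0`. This makes it closed and
    -- costs nothing, because `I_x` is infinite there.
    have hF : IsClosed ({p : PairSpace q | 0 < p.ofLp.2} ∩ pairRatio ⁻¹' Vᶜ)ᶜ :=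
      (continuousOn_pairRatio.isOpen_inter_preimage isOpen_pos_snd hV.isOpen_compl).isClosed_compl
    have hup := gartnerEllis_upper h_infty hint hlim hF (α := α) (hα.trans_le ?_)
    · filter_upwards [hup] with n hn
      refine le_trans (measureReal_mono fun ω hω => ?_) hn
      have hω' : nadarayaWatson K h X Y x n ω ∈ V := hω
      rw [nadarayaWatson_eq_pairRatio] at hω'
      exact fun hc => hc.2 hω'
    · refine le_iInf₂ fun p hp => ?_
      rw [← regI_eq_legendre]
      by_cases hp0 : 0 < p.ofLp.2
      · have hpV : pairRatio p ∈ V := by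
          by_contra hc
          exact hp ⟨hp0, hc⟩
        exact (iInf₂_le _ hpV).trans (regJ_pairRatio_le hp0)
      · rw [regI_eq_top hK hK_supp hg _ (not_lt.1 hp0)]
        exact le_top

lemma regPsi_congr (hKK' : K =ᵐ[volume] K') (u : EuclideanSpace ℝ (Fin q)) (v : ℝ) :
    regPsi K f x u v = regPsi K' f x u v := by
  refine integral_congr_ae ?_
  have h1 : ∀ᵐ p : EuclideanSpace ℝ (Fin d) × EuclideanSpace ℝ (Fin q), K p.1 = K' p.1 := by
    rw [Measure.volume_eq_prod]
    exact Measure.quasiMeasurePreserving_fst.ae hKK'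
  filter_upwards [h1] with p hp
  rw [hp]

lemma regJ_congr (hKK' : K =ᵐ[volume] K') : regJ K f x = regJ K' f x := by
  funext s
  simp only [regJ, regI, regPsi_congr hKK']

/-- The map `t ↦ (x - t) / h_n` pulls null sets back to null sets and each observation has a
density, so almost surely no sample point meets the set where the kernels differ. -/
lemma nadarayaWatson_congr (hKK' : K =ᵐ[volume] K') (hX : ∀ i, Measurable (X i))
    (hY : ∀ i, Measurable (Y i))
    (h_law : ∀ i, P.map (fun ω => (X i ω, Y i ω)) =
      (volume : Measure (EuclideanSpace ℝ (Fin d) × EuclideanSpace ℝ (Fin q))).withDensity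
        (fun p => ENNReal.ofReal (f p.1 p.2)))
    {n : ℕ} (hn : 0 < h n) :
    nadarayaWatson K h X Y x n =ᵐ[P] nadarayaWatson K' h X Y x n := by
  have h1 : ∀ᵐ t : EuclideanSpace ℝ (Fin d),
      K ((h n)⁻¹ • (x - t)) = K' ((h n)⁻¹ • (x - t)) := by
    have hq1 : Measure.QuasiMeasurePreserving (fun t : EuclideanSpace ℝ (Fin d) => x - t)
        volume volume := quasiMeasurePreserving_sub_left volume x
    have hq2 : Measure.QuasiMeasurePreserving
        (fun t : EuclideanSpace ℝ (Fin d) => (h n)⁻¹ • t) volume volume := by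
      refine ⟨by fun_prop, ?_⟩
      rw [Measure.map_addHaar_smul volume (inv_ne_zero hn.ne')]
      exact Measure.smul_absolutelyContinuous
    exact (hq2.comp hq1).ae hKK'
  have h2 : ∀ i, ∀ᵐ ω ∂P, K ((h n)⁻¹ • (x - X i ω)) = K' ((h n)⁻¹ • (x - X i ω)) := by
    intro i
    have h3 : ∀ᵐ p : EuclideanSpace ℝ (Fin d) × EuclideanSpace ℝ (Fin q),
        K ((h n)⁻¹ • (x - p.1)) = K' ((h n)⁻¹ • (x - p.1)) := by
      rw [Measure.volume_eq_prod]
      exact Measure.quasiMeasurePreserving_fst.ae h1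
    have h4 := (withDensity_absolutelyContinuous volume
      (fun p : EuclideanSpace ℝ (Fin d) × EuclideanSpace ℝ (Fin q) =>
        ENNReal.ofReal (f p.1 p.2))).ae_le h3
    rw [← h_law i] at h4
    exact ae_of_ae_map ((hX i).prodMk (hY i)).aemeasurable h4
  filter_upwards [ae_all_iff.2 h2] with ω hω
  simp only [nadarayaWatson_eq_pairRatio, kernelPair, kernelG, kernelM, hω]

lemma SatisfiesLDP.congr {E : Type*} [TopologicalSpace E] {Z Z' : ℕ → Ω → E} {ν : ℕ → ℝ}
    {I : E → EReal} (hZ : ∀ᶠ n in atTop, Z n =ᵐ[P] Z' n) (hLDP : SatisfiesLDP P Z ν I) :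
    SatisfiesLDP P Z' ν I := by
  have hA : ∀ A : Set E, (fun n => (((ν n)⁻¹ : ℝ) : EReal) * ENNReal.log (P {ω | Z n ω ∈ A}))
      =ᶠ[atTop] fun n => (((ν n)⁻¹ : ℝ) : EReal) * ENNReal.log (P {ω | Z' n ω ∈ A}) := by
    intro A
    filter_upwards [hZ] with n hn
    congr 2
    refine measure_congr ?_
    filter_upwards [hn] with ω hω
    exact congrArg (· ∈ A) hω
  obtain ⟨h1, h2, h3, h4⟩ := hLDP
  refine ⟨h1, h2, fun U hU => ?_, fun V hV => ?_⟩
  · rw [← liminf_congr (hA U)]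
    exact h3 U hU
  · rw [← limsup_congr (hA V)]
    exact h4 V hV

/-- A nonnegative bounded integrable function has a Borel version with the same properties. -/
lemma exists_isBoundedKernel_ae_eq (hK_le : ∀ z, |K z| ≤ C) (hK_int : Integrable K)
    (hK_nonneg : ∀ z, 0 ≤ K z) : ∃ K', IsBoundedKernel K' C ∧ K =ᵐ[volume] K' := by
  have hC : 0 ≤ C := (abs_nonneg _).trans (hK_le 0)
  set k := hK_int.aestronglyMeasurable.mk K with hk
  have hkm : Measurable k := hK_int.aestronglyMeasurable.stronglyMeasurable_mk.measurable
  -- Clipping to `[0, C]` makes the bounds hold at every point and changes nothing where `k` agrees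
  -- with `K`.
  have hae : K =ᵐ[volume] fun z => max 0 (min C (k z)) := by
    filter_upwards [hK_int.aestronglyMeasurable.ae_eq_mk] with z hz
    rw [hk, ← hz, min_eq_right ((le_abs_self _).trans (hK_le z)), max_eq_right (hK_nonneg z)]
  exact ⟨_, ⟨by fun_prop, fun z => le_max_left _ _, fun z => max_le hC (min_le_left _ _),
    hK_int.congr hae⟩, hae⟩

end Deviations

theorem corollary1 {Ω : Type*} [MeasurableSpace Ω] (P : Measure Ω) [IsProbabilityMeasure P]
    (d q : ℕ)
    (X : ℕ → Ω → EuclideanSpace ℝ (Fin d)) (Y : ℕ → Ω → EuclideanSpace ℝ (Fin q))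
    (hX : ∀ i, Measurable (X i)) (hY : ∀ i, Measurable (Y i))
    -- the pairs are i.i.d. with probability density `f`, and `E‖Y‖ < ∞`
    (f : EuclideanSpace ℝ (Fin d) → EuclideanSpace ℝ (Fin q) → ℝ)
    (hf_meas : Measurable (Function.uncurry f)) (hf_nonneg : ∀ t y, 0 ≤ f t y)
    (h_indep : iIndepFun (fun i ω => (X i ω, Y i ω)) P)
    (h_law : ∀ i, P.map (fun ω => (X i ω, Y i ω)) =
      (volume : Measure (EuclideanSpace ℝ (Fin d) × EuclideanSpace ℝ (Fin q))).withDensity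
        (fun p => ENNReal.ofReal (f p.1 p.2)))
    (hY_int : ∀ i, Integrable (Y i) P)
    -- the bandwidth
    (h : ℕ → ℝ) (h_pos : ∀ n, 1 ≤ n → 0 < h n) (h_zero : Tendsto h atTop (𝓝 0))
    (h_infty : Tendsto (fun n : ℕ => (n : ℝ) * h n ^ d) atTop atTop)
    -- the kernel
    (K : EuclideanSpace ℝ (Fin d) → ℝ)
    (hK_bdd : ∃ C : ℝ, ∀ z, |K z| ≤ C) (hK_int : Integrable K) (hK_one : ∫ z, K z = 1)
    (hK_lim : Tendsto K (cocompact (EuclideanSpace ℝ (Fin d))) (𝓝 0))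
    (hK_nonneg : ∀ z, 0 ≤ K z) (hK_supp : volume {z | 0 < K z} = ⊤)
    -- the point `x`, at which the marginal density of `X` does not vanish
    (x : EuclideanSpace ℝ (Fin d)) (hg : 0 < ∫ y, f x y)
    -- `t ↦ ∫ e^{⟨u, y⟩} f(t, y) dy` is finite, bounded, and continuous at `x`
    (hf_fin : ∀ u t, Integrable (fun y => Real.exp (inner ℝ u y) * f t y))
    (hf_bdd : ∀ u, ∃ C : ℝ, ∀ t, ∫ y, Real.exp (inner ℝ u y) * f t y ≤ C)
    (hf_cont : ∀ u, ContinuousAt (fun t => ∫ y, Real.exp (inner ℝ u y) * f t y) x) :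
    IsGoodRateFunction (regJ K f x) ∧
      SatisfiesLDP P (fun n => nadarayaWatson K h X Y x n) (fun n => (n : ℝ) * h n ^ d)
        (regJ K f x) := by
  obtain ⟨C, hC⟩ := hK_bdd
  -- Integrability makes `K` only almost everywhere measurable, whereas the cumulant computation
  -- composes the kernel with `X i` and needs a Borel version.
  obtain ⟨K', hK', hKK'⟩ := exists_isBoundedKernel_ae_eq hC hK_int hK_nonneg
  have hf : HasUniformExpMoments f := ⟨hf_meas, hf_nonneg, hf_fin, hf_bdd⟩
  have hsupp : volume {z | 0 < K' z} = ⊤ := by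
    rw [← hK_supp]
    refine measure_congr ?_
    filter_upwards [hKK'] with z hz
    exact congrArg (0 < ·) hz.symm
  rw [regJ_congr hKK']
  refine ⟨isGoodRateFunction_regJ hK' hsupp hg, ?_⟩
  refine (satisfiesLDP_nadarayaWatson hf hK' hX hY h_indep h_law h_pos h_zero h_infty hsupp hg
    hf_cont).congr ?_
  filter_upwards [eventually_ge_atTop 1] with n hn
  exact (nadarayaWatson_congr hKK' hX hY h_law (h_pos n hn)).symm
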